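/- Let $F_v=\mathbb{R}$ or $F_v=\mathbb{C}$ (the completion of a number field at an archimedean place) and let $s\in\mathbb{C}$ with $\Re(s)\le 1/2$. If $F_v=\mathbb{R}$, put $\psi(x)=e^{2\pi i x}$, $\zeta_{\mathbb{R}}(w)=\pi^{-w/2}\Gamma(w/2)$, $t(x)=(1+x^2)^{-1/2}$, let $dx$ be Lebesgue measure and $\partial=u\frac{d}{du}$. If $F_v=\mathbb{C}$, put $\psi(z)=e^{4\pi i\,\Re(z)}$, $\zeta_{\mathbb{C}}(w)=(2\pi)^{1-w}\Gamma(w)$, $t(z)=(1+|z|^2)^{-1}$ with the usual modulus $|z|$, let $dx$ be twice Lebesgue measure (the self-dual measure for $\psi$) and $\partial=z\frac{\partial}{\partial z}$, where $\frac{\partial}{\partial z}=\frac12\left(\frac{\partial}{\partial x}-i\frac{\partial}{\partial y}\right)$. For $u\in F_v^\times$ define the basic function $$\mathbb{L}_v(u,s)=\zeta_{F_v}(2-2s)\int_{F_v}\psi(ux)\,t(x)^{2-2s}\,dx\qquad(\Re(s)<1/2),$$ and by analytic continuation in $s$ otherwise (for fixed $u\in F_v^\times$ it extends to an entire function of $s$).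 Let $\mathcal{S}_\rho^\circ(F_v^\times)$ be the space of functions $P\,\mathbb{L}_v(\cdot,s)$, where $P$ runs over the algebra $\mathbb{C}[u,\partial]$ of operators generated by multiplication by $u$ and by $\partial$ if $F_v=\mathbb{R}$, and over the algebra $\mathbb{C}[z,\bar z,\partial]$ generated by multiplication by $z$, multiplication by $\bar z$, and $\partial$ if $F_v=\mathbb{C}$. Then $\mathcal{S}_\rho^\circ(F_v^\times)$ is contained in $L^2(F_v,dx)$ and is dense in it. -/

import Mathlib

open MeasureTheory

noncomputable section

namespace TameSchwartz

/-- The continuation in `s` of a function given on the half plane `Re w < 1/2`: the value at `s` of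
the entire function that agrees with `f` on this half plane (it is unique, see
`entireExtension_unique`); if there is none, the value is `f s`. -/
def continuation (f : ℂ → ℂ) (s : ℂ) : ℂ :=
  open Classical in
  if h : ∃ g : ℂ → ℂ, Differentiable ℂ g ∧ ∀ w : ℂ, w.re < 1 / 2 → g w = f w then h.choose s
  else f s

theorem entireExtension_unique {f g₁ g₂ : ℂ → ℂ}
    (h₁ : Differentiable ℂ g₁ ∧ ∀ w : ℂ, w.re < 1 / 2 → g₁ w = f w)
    (h₂ : Differentiable ℂ g₂ ∧ ∀ w : ℂ, w.re < 1 / 2 → g₂ w = f w) : g₁ = g₂ := by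
  have a₁ : AnalyticOnNhd ℂ g₁ Set.univ := fun z _ => h₁.1.analyticAt z
  have a₂ : AnalyticOnNhd ℂ g₂ Set.univ := fun z _ => h₂.1.analyticAt z
  refine a₁.eq_of_eventuallyEq a₂ (z₀ := 0) ?_
  have ho : IsOpen {w : ℂ | w.re < 1 / 2} := isOpen_lt Complex.continuous_re continuous_const
  filter_upwards [ho.mem_nhds (show (0 : ℂ) ∈ {w : ℂ | w.re < 1 / 2} by simp)] with w hw
  rw [h₁.2 w hw, h₂.2 w hw]

theorem continuation_eq {f g : ℂ → ℂ} (hg : Differentiable ℂ g)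
    (hgf : ∀ w : ℂ, w.re < 1 / 2 → g w = f w) (s : ℂ) : continuation f s = g s := by
  have h : ∃ g : ℂ → ℂ, Differentiable ℂ g ∧ ∀ w : ℂ, w.re < 1 / 2 → g w = f w := ⟨g, hg, hgf⟩
  rw [continuation, dif_pos h, entireExtension_unique h.choose_spec ⟨hg, hgf⟩]

/-! ### The real place -/

/-- The additive character `ψ(x) = exp(2πix)` of `ℝ`. -/
def psiReal (x : ℝ) : ℂ := Complex.exp (2 * Real.pi * Complex.I * x)

/-- `ζ_ℝ(s) = π^(-s/2) Γ(s/2)`. -/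
def zetaReal (s : ℂ) : ℂ := (Real.pi : ℂ) ^ (-s / 2) * Complex.Gamma (s / 2)

/-- The Iwasawa height `t(ν(x)) = (1 + x²)^(-1/2)` of the unipotent matrix `[1, x; 0, 1]` over
`ℝ`. -/
def heightReal (x : ℝ) : ℝ := (Real.sqrt (1 + x ^ 2))⁻¹

/-- The basic function `𝕃(u, s)` of `ℝ`, as a function of `u ∈ ℝˣ`
(the value at `u = 0` plays no role): the continuation to all `s` of
`ζ_ℝ(2-2s) ∫ ψ(ux) t(ν(x))^(2-2s) dx`, which converges for `Re s < 1/2`. -/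
def basicReal (s : ℂ) (u : ℝ) : ℂ :=
  continuation (fun w => zetaReal (2 - 2 * w) *
    ∫ x : ℝ, psiReal (u * x) * (heightReal x : ℂ) ^ (2 - 2 * w)) s

/-- The Euler operator `∂ = u d/du`. -/
def eulerReal (f : ℝ → ℂ) : ℝ → ℂ := fun u => (u : ℂ) * deriv f u

/-- The action of `P(u, ∂) = ∑ⱼ pⱼ(u) ∂ʲ` on functions. As `∂ u = u ∂ + u`, these are all the
operators in the algebra `ℂ[u, ∂]` generated by `u` and `∂`. -/
def applyReal (P : Polynomial (Polynomial ℂ)) (f : ℝ → ℂ) : ℝ → ℂ :=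
  fun u => P.sum fun j p => p.eval (u : ℂ) * (eulerReal^[j] f) u

/-- The tame `ρ`-Schwartz space of `ℝˣ`: all `P(u, ∂) 𝕃(u, s)`. -/
def tameReal (s : ℂ) : Set (ℝ → ℂ) :=
  Set.range fun P : Polynomial (Polynomial ℂ) => applyReal P (basicReal s)

/-! ### The complex place -/

/-- The additive character `ψ(z) = exp(4πi Re z)` of `ℂ`. -/
def psiComplex (z : ℂ) : ℂ := Complex.exp (4 * Real.pi * Complex.I * z.re)

/-- `ζ_ℂ(s) = (2π)^(1-s) Γ(s)`. -/
def zetaComplex (s : ℂ) : ℂ := (2 * Real.pi : ℂ) ^ (1 - s) * Complex.Gamma s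

/-- The Haar measure of `ℂ` that is self-dual for `psiComplex`: twice the Lebesgue measure. -/
def haarComplex : Measure ℂ := (2 : ENNReal) • (volume : Measure ℂ)

/-- The Iwasawa height `t(ν(z)) = (1 + |z|²)⁻¹` of the unipotent matrix `[1, z; 0, 1]` over `ℂ`,
where `|z|` is the usual modulus. -/
def heightComplex (z : ℂ) : ℝ := (1 + ‖z‖ ^ 2)⁻¹

/-- The basic function `𝕃(u, s)` of `ℂ`, as a function of `u ∈ ℂˣ`
(the value at `u = 0` plays no role): the continuation to all `s` of
`ζ_ℂ(2-2s) ∫ ψ(uz) t(ν(z))^(2-2s) dz`, which converges for `Re s < 1/2`. -/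
def basicComplex (s : ℂ) (u : ℂ) : ℂ :=
  continuation (fun w => zetaComplex (2 - 2 * w) *
    ∫ z : ℂ, psiComplex (u * z) * (heightComplex z : ℂ) ^ (2 - 2 * w) ∂haarComplex) s

/-- The operator `∂ = z d/dz`, with the Wirtinger derivative `d/dz = (d/dx - i d/dy) / 2`. -/
def eulerComplex (f : ℂ → ℂ) : ℂ → ℂ :=
  fun z => z * ((fderiv ℝ f z 1 - Complex.I * fderiv ℝ f z Complex.I) / 2)

/-- The action of `P(z, z̄, ∂) = ∑ⱼ pⱼ(z, z̄) ∂ʲ` on functions. As `∂ z = z ∂ + z` and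
`∂ z̄ = z̄ ∂`, these are all the operators in the algebra `ℂ[z, z̄, ∂]` generated by `z`, `z̄` and
`∂`. -/
def applyComplex (P : Polynomial (MvPolynomial (Fin 2) ℂ)) (f : ℂ → ℂ) : ℂ → ℂ :=
  fun z => P.sum fun j p =>
    MvPolynomial.eval ![z, (starRingEnd ℂ) z] p * (eulerComplex^[j] f) z

/-- The tame `ρ`-Schwartz space of `ℂˣ`: all `P(z, z̄, ∂) 𝕃(z, s)`. -/
def tameComplex (s : ℂ) : Set (ℂ → ℂ) :=
  Set.range fun P : Polynomial (MvPolynomial (Fin 2) ℂ) => applyComplex P (basicComplex s)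

end TameSchwartz

end

/-! Writing the power of `1 + ‖x‖ ^ 2` as a Gamma integral of Gaussians and taking Fourier
transforms (`fourier_one_add_normSq_cpow`) turns both basic functions into constant multiples of one
Bessel integral `besselInt b ν` at `‖u‖ ^ 2`, with `Re ν ≥ 0` exactly when `Re s ≤ 1/2`. That
integral is entire in `ν`, which gives the continuation in `s`.

Containment: the Euler operators act as multiples of `r d/dr`, `r = ‖u‖ ^ 2`, and preserve the span
of the functions `r ^ k * besselInt b (ν - k) r` (`exists_hasDerivAt_besselSum`). Each of these is
`O(exp(-b‖u‖) ‖u‖ ^ (-1/4))` (`exists_norm_besselInt_le`), so it stays square integrable after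
multiplication by polynomials.

Density: polynomial multiples of the basic function `f` already suffice. If `h` is orthogonal to all
of them, then `φ = h * conj f` has vanishing moments. Since `φ` decays exponentially in the integral
sense, its Fourier transform vanishes (`ae_eq_zero_of_moments_eq_zero`), so `φ = 0` almost
everywhere. By analyticity `f` vanishes only on countably many spheres and possibly at the origin,
hence `h = 0`. -/

noncomputable section

namespace TameSchwartz

open Set Filter Topology Asymptotics

/-! ### Bessel integrals: convergence, analyticity, zeros and decay. -/

/-- The kernel `exp(-b(y + r/y))`. -/
def besselKernel (b : ℝ) (r : ℂ) (y : ℝ) : ℂ := Complex.exp (-b * (y + r / y))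

/-- The integral `∫₀^∞ y^(ν-1) exp(-b(y + r/y)) dy`, a form of the modified Bessel function
`2 r^(ν/2) K_ν(2b√r)`. -/
def besselInt (b : ℝ) (ν r : ℂ) : ℂ := mellin (besselKernel b r) ν

theorem besselInt_eq (b : ℝ) (ν r : ℂ) :
    besselInt b ν r = ∫ y : ℝ in Ioi 0, (y : ℂ) ^ (ν - 1) * besselKernel b r y := rfl

theorem norm_besselKernel (b : ℝ) (r : ℂ) (y : ℝ) :
    ‖besselKernel b r y‖ = Real.exp (-b * y) * Real.exp (-(b * r.re) * y⁻¹) := by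
  rw [besselKernel, Complex.norm_exp, ← Real.exp_add]
  congr 1
  simp [Complex.div_ofReal_re]
  ring

theorem continuousOn_besselKernel (b : ℝ) (r : ℂ) : ContinuousOn (besselKernel b r) (Ioi 0) := by
  unfold besselKernel
  refine Complex.continuous_exp.comp_continuousOn (continuousOn_const.mul
    (Complex.continuous_ofReal.continuousOn.add (continuousOn_const.div
      Complex.continuous_ofReal.continuousOn ?_)))
  intro y hy
  exact_mod_cast (ne_of_gt hy)

theorem besselKernel_isBigO_atTop {b : ℝ} (hb : 0 < b) {r : ℂ} (hr : 0 < r.re) :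
    besselKernel b r =O[atTop] fun y => Real.exp (-b * y) := by
  refine IsBigO.of_bound 1 ?_
  filter_upwards [eventually_gt_atTop 0] with y hy
  rw [norm_besselKernel, Real.norm_of_nonneg (Real.exp_pos _).le, one_mul]
  refine mul_le_of_le_one_right (Real.exp_pos _).le (Real.exp_le_one_iff.2 ?_)
  have : 0 < b * r.re * y⁻¹ := by positivity
  linarith

/-- The factor `exp(-b Re r / y)` beats every power of `y` at `0`, so the Mellin transform converges
for every order `ν`. -/
theorem besselKernel_isBigO_zero {b : ℝ} (hb : 0 < b) {r : ℂ} (hr : 0 < r.re) (a : ℝ) :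
    besselKernel b r =O[𝓝[>] 0] fun y => y ^ (-a) := by
  have h1 : besselKernel b r =O[𝓝[>] 0] fun y : ℝ => Real.exp (-(b * r.re) * y⁻¹) := by
    refine IsBigO.of_bound 1 ?_
    filter_upwards [self_mem_nhdsWithin] with y hy
    rw [norm_besselKernel, Real.norm_of_nonneg (Real.exp_pos _).le, one_mul]
    refine mul_le_of_le_one_left (Real.exp_pos _).le (Real.exp_le_one_iff.2 ?_)
    have : 0 < b * y := mul_pos hb hy
    linarith
  refine h1.trans ?_
  have h2 := ((isLittleO_exp_neg_mul_rpow_atTop (mul_pos hb hr) a).isBigO).comp_tendsto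
    (tendsto_inv_nhdsGT_zero (𝕜 := ℝ))
  refine h2.congr' (Eventually.of_forall fun _ => rfl) ?_
  filter_upwards [self_mem_nhdsWithin] with y hy
  simp only [Function.comp]
  rw [Real.inv_rpow (le_of_lt hy), Real.rpow_neg (le_of_lt hy)]

theorem locallyIntegrableOn_besselKernel (b : ℝ) (r : ℂ) :
    LocallyIntegrableOn (besselKernel b r) (Ioi 0) :=
  (continuousOn_besselKernel b r).locallyIntegrableOn measurableSet_Ioi

theorem integrableOn_besselKernel {b : ℝ} (hb : 0 < b) (ν : ℂ) {r : ℂ} (hr : 0 < r.re) :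
    IntegrableOn (fun y : ℝ => (y : ℂ) ^ (ν - 1) * besselKernel b r y) (Ioi 0) :=
  mellinConvergent_of_isBigO_rpow_exp hb (locallyIntegrableOn_besselKernel b r)
    (besselKernel_isBigO_atTop hb hr) (besselKernel_isBigO_zero hb hr (ν.re - 1)) (by linarith)

theorem differentiable_besselInt_order {b : ℝ} (hb : 0 < b) {r : ℂ} (hr : 0 < r.re) :
    Differentiable ℂ fun ν => besselInt b ν r := fun ν =>
  mellin_differentiableAt_of_isBigO_rpow_exp hb (locallyIntegrableOn_besselKernel b r)
    (besselKernel_isBigO_atTop hb hr) (besselKernel_isBigO_zero hb hr (ν.re - 1)) (by linarith)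

theorem hasDerivAt_besselInt {b : ℝ} (hb : 0 < b) (ν : ℂ) {r : ℂ} (hr : 0 < r.re) :
    HasDerivAt (besselInt b ν) (-b * besselInt b (ν - 1) r) r := by
  have hr2 : 0 < ((r.re / 2 : ℝ) : ℂ).re := by simpa using hr
  have hs : {z : ℂ | r.re / 2 < z.re} ∈ 𝓝 r :=
    (isOpen_lt continuous_const Complex.continuous_re).mem_nhds (by simp; linarith)
  have key := (hasDerivAt_integral_of_dominated_loc_of_deriv_le (μ := volume.restrict (Ioi (0:ℝ)))
    (F := fun z y => (y : ℂ) ^ (ν - 1) * besselKernel b z y)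
    (F' := fun z y => -b * ((y : ℂ) ^ (ν - 1 - 1) * besselKernel b z y)) (x₀ := r)
    -- The kernel's norm decreases in `Re z`, so its value at `Re r / 2` dominates on the half plane
    -- `Re z > Re r / 2`.
    (bound := fun y => ‖(-b : ℂ) * ((y : ℂ) ^ (ν - 1 - 1) * besselKernel b (r.re / 2 : ℝ) y)‖)
    hs ?_ (integrableOn_besselKernel hb ν hr)
    ((integrableOn_besselKernel hb (ν - 1) hr).const_mul _).aestronglyMeasurable ?_
    (((integrableOn_besselKernel hb (ν - 1) hr2).const_mul _).norm) ?_).2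
  · rw [integral_const_mul] at key
    exact key
  · filter_upwards [(isOpen_lt continuous_const Complex.continuous_re).mem_nhds hr] with z hz
    exact (integrableOn_besselKernel hb ν hz).aestronglyMeasurable
  · filter_upwards [ae_restrict_mem measurableSet_Ioi] with y hy z hz
    have hy0 : 0 < y := hy
    rw [norm_mul, norm_mul, norm_mul, norm_mul, norm_besselKernel, norm_besselKernel,
      Complex.ofReal_re]
    have hz' : b * (r.re / 2) * y⁻¹ ≤ b * z.re * y⁻¹ := by
      have : r.re / 2 ≤ z.re := le_of_lt hz
      gcongr
    have h3 : Real.exp (-(b * z.re) * y⁻¹) ≤ Real.exp (-(b * (r.re / 2)) * y⁻¹) :=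
      Real.exp_le_exp.2 (by linarith)
    gcongr
  · filter_upwards [ae_restrict_mem measurableSet_Ioi] with y hy z hz
    have hy0 : (y : ℂ) ≠ 0 := by exact_mod_cast (ne_of_gt hy)
    have h1 : HasDerivAt (fun z : ℂ => -(b : ℂ) * (y + z / y)) (-b * (1 / y)) z :=
      (((hasDerivAt_id z).div_const (y : ℂ)).const_add (y : ℂ)).const_mul _
    have h2 := (h1.cexp).const_mul ((y : ℂ) ^ (ν - 1))
    refine h2.congr_deriv ?_
    rw [Complex.cpow_sub (ν - 1) 1 hy0, Complex.cpow_one, besselKernel]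
    ring

theorem analyticOnNhd_besselInt {b : ℝ} (hb : 0 < b) (ν : ℂ) :
    AnalyticOnNhd ℂ (besselInt b ν) {z | 0 < z.re} := by
  refine DifferentiableOn.analyticOnNhd (fun z hz => ?_)
    (isOpen_lt continuous_const Complex.continuous_re)
  exact (hasDerivAt_besselInt hb ν hz).differentiableAt.differentiableWithinAt

theorem isPreconnected_rightHalfPlane : IsPreconnected {z : ℂ | 0 < z.re} :=
  (convex_halfSpace_re_gt 0).isPreconnected

/-- Zeros of a nonzero analytic function on a connected domain are isolated, and a discrete set in a
hereditarily Lindelöf space is countable. -/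
theorem countable_zeros_besselInt {b : ℝ} (hb : 0 < b) (ν : ℂ) {r₀ : ℂ} (hr₀ : 0 < r₀.re)
    (h₀ : besselInt b ν r₀ ≠ 0) : {r : ℝ | 0 < r ∧ besselInt b ν r = 0}.Countable := by
  have h := (analyticOnNhd_besselInt hb ν).preimage_zero_mem_codiscreteWithin h₀ hr₀
    ⟨⟨r₀, hr₀⟩, isPreconnected_rightHalfPlane⟩
  have h2 := isDiscrete_of_codiscreteWithin h
  have h3 : (besselInt b ν ⁻¹' {0} ∩ {z : ℂ | 0 < z.re}).Countable := by
    exact (HereditarilyLindelofSpace.isLindelof _).countable_of_isDiscrete h2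
  refine (h3.preimage Complex.ofReal_injective).mono ?_
  rintro r ⟨h1, h2⟩
  exact ⟨h2, by simpa using h1⟩

theorem integrableOn_rpow_mul_exp_neg_mul {σ c : ℝ} (hσ : 0 < σ) (hc : 0 < c) :
    IntegrableOn (fun y : ℝ => y ^ (σ - 1) * Real.exp (-c * y)) (Ioi 0) := by
  simpa using integrableOn_rpow_mul_exp_neg_mul_rpow (s := σ - 1) (p := 1) (by linarith) one_pos hc

theorem exists_rpow_mul_exp_neg_le {c : ℝ} (hc : 0 < c) (k : ℕ) :
    ∃ C : ℝ, 0 ≤ C ∧ ∀ t : ℝ, 0 < t → t ^ k * Real.exp (-c * t) ≤ C * t ^ (-(1 / 8) : ℝ) := by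
  refine ⟨1 + (k + 1).factorial / c ^ (k + 1), by positivity, fun t ht => ?_⟩
  have h1 : t ^ k = t ^ ((k : ℝ) + 1 / 8) * t ^ (-(1 / 8) : ℝ) := by
    rw [← Real.rpow_add ht, ← Real.rpow_natCast]
    congr 1
    ring
  have h2 : t ^ ((k : ℝ) + 1 / 8) ≤ 1 + t ^ (k + 1) := by
    rcases le_total t 1 with h | h
    · have := Real.rpow_le_one ht.le h (show (0 : ℝ) ≤ (k : ℝ) + 1 / 8 by positivity)
      have : 0 ≤ t ^ (k + 1) := by positivity
      linarith
    · have := Real.rpow_le_rpow_of_exponent_le h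
        (show (k : ℝ) + 1 / 8 ≤ ((k + 1 : ℕ) : ℝ) by push_cast; linarith)
      rw [Real.rpow_natCast] at this
      linarith
  have h3 : t ^ (k + 1) * Real.exp (-c * t) ≤ (k + 1).factorial / c ^ (k + 1) := by
    have := Real.pow_div_factorial_le_exp (c * t) (by positivity) (k + 1)
    rw [neg_mul, Real.exp_neg, ← div_eq_mul_inv, div_le_div_iff₀ (Real.exp_pos _) (by positivity)]
    rw [div_le_iff₀ (by positivity), mul_pow] at this
    linarith
  have h4 : Real.exp (-c * t) ≤ 1 := Real.exp_le_one_iff.2 (by nlinarith)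
  rw [h1, mul_right_comm]
  gcongr
  calc t ^ ((k : ℝ) + 1 / 8) * Real.exp (-c * t) ≤ (1 + t ^ (k + 1)) * Real.exp (-c * t) := by gcongr
    _ ≤ _ := by rw [add_mul, one_mul]; exact add_le_add h4 h3

/-- By `y + r/y ≥ 2√r`, half of the exponent yields `exp(-b√r)`. In the other half, `exp(-b r /
(2y))` absorbs `(r/y) ^ k` at the price of `(r/y) ^ (-1/8)`. The gained `y ^ (1/8)` makes the
integral converge at `0` even when `Re ν = 0`. -/
theorem exists_norm_besselInt_le {b : ℝ} (hb : 0 < b) {ν : ℂ} (hν : 0 ≤ ν.re) (k : ℕ) :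
    ∃ C : ℝ, 0 ≤ C ∧ ∀ r : ℝ, 0 < r →
      ‖(r : ℂ) ^ k * besselInt b (ν - k) r‖ ≤
        C * (Real.exp (-b * √r) * r ^ (-(1 / 8) : ℝ)) := by
  obtain ⟨C, hC, h⟩ := exists_rpow_mul_exp_neg_le (half_pos hb) k
  have hint := integrableOn_rpow_mul_exp_neg_mul (show 0 < ν.re + 1 / 8 by linarith) (half_pos hb)
  refine ⟨C * ∫ y in Ioi (0 : ℝ), y ^ (ν.re + 1 / 8 - 1) * Real.exp (-(b / 2) * y),
    mul_nonneg hC (setIntegral_nonneg measurableSet_Ioi fun y (hy : 0 < y) => by positivity),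
    fun r hr => ?_⟩
  rw [besselInt_eq, ← integral_const_mul]
  have := norm_integral_le_of_norm_le (f := fun y : ℝ => (r : ℂ) ^ k *
      ((y : ℂ) ^ (ν - k - 1) * besselKernel b r y))
    (hint.const_mul (C * (Real.exp (-b * √r) * r ^ (-(1 / 8) : ℝ)))) ?_
  · refine this.trans_eq ?_
    rw [integral_const_mul]
    ring
  filter_upwards [ae_restrict_mem measurableSet_Ioi] with y hy
  have hy0 : 0 < y := hy
  have hyk : y ^ ((ν - k - 1).re) = y ^ (ν.re - 1) / y ^ k := by
    rw [← Real.rpow_natCast, ← Real.rpow_sub hy0]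
    congr 1
    simp
    ring
  rw [norm_mul, norm_mul, norm_pow, Complex.norm_real, Real.norm_of_nonneg hr.le,
    Complex.norm_cpow_eq_rpow_re_of_pos hy0, norm_besselKernel, hyk, Complex.ofReal_re]
  have hsq : 2 * √r ≤ y + r * y⁻¹ := by
    have h1 := sq_nonneg (√y - √r / √y)
    have h2 : 0 < √y := Real.sqrt_pos.2 hy0
    have h3 : √y ^ 2 = y := Real.sq_sqrt hy0.le
    have h4 : √r ^ 2 = r := Real.sq_sqrt hr.le
    have h5 : (√y - √r / √y) ^ 2 = √y ^ 2 - 2 * √r + √r ^ 2 / √y ^ 2 := by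
      field_simp
      ring
    rw [h5, h3, h4, div_eq_mul_inv] at h1
    linarith
  have hexp : Real.exp (-b * y) * Real.exp (-(b * r) * y⁻¹) ≤
      Real.exp (-b * √r) * Real.exp (-(b / 2) * y) * Real.exp (-(b / 2) * (r * y⁻¹)) := by
    rw [← Real.exp_add, ← Real.exp_add, ← Real.exp_add]
    apply Real.exp_le_exp.2
    nlinarith
  have ht := h (r * y⁻¹) (by positivity)
  have hyr : (r * y⁻¹) ^ (-(1 / 8) : ℝ) = r ^ (-(1 / 8) : ℝ) * y ^ (1 / 8 : ℝ) := by
    rw [Real.mul_rpow hr.le (by positivity), Real.inv_rpow hy0.le, Real.rpow_neg hy0.le, inv_inv]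
  have hys : y ^ (ν.re + 1 / 8 - 1) = y ^ (ν.re - 1) * y ^ (1 / 8 : ℝ) := by
    rw [← Real.rpow_add hy0]
    congr 1
    ring
  rw [hyr] at ht
  rw [hys]
  calc r ^ k * (y ^ (ν.re - 1) / y ^ k * (Real.exp (-b * y) * Real.exp (-(b * r) * y⁻¹)))
      ≤ r ^ k * (y ^ (ν.re - 1) / y ^ k * (Real.exp (-b * √r) * Real.exp (-(b / 2) * y) *
          Real.exp (-(b / 2) * (r * y⁻¹)))) := by gcongr
    _ = y ^ (ν.re - 1) * Real.exp (-b * √r) * Real.exp (-(b / 2) * y) *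
          ((r * y⁻¹) ^ k * Real.exp (-(b / 2) * (r * y⁻¹))) := by
        rw [mul_pow, inv_pow]; ring
    _ ≤ y ^ (ν.re - 1) * Real.exp (-b * √r) * Real.exp (-(b / 2) * y) *
          (C * (r ^ (-(1 / 8) : ℝ) * y ^ (1 / 8 : ℝ))) := by gcongr
    _ = _ := by ring

/-- Fubini, with inner integral `∫ exp(-b r / y) dr = y / b`. The value is nonzero, so `besselInt b
ν` cannot vanish identically. -/
theorem integral_besselInt {b : ℝ} (hb : 0 < b) {ν : ℂ} (hν : -1 < ν.re) :
    ∫ r : ℝ in Ioi 0, besselInt b ν r =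
      (b : ℂ)⁻¹ * ((1 / b : ℂ) ^ (ν + 1) * Complex.Gamma (ν + 1)) := by
  set F : ℝ → ℝ → ℂ := fun r y => (y : ℂ) ^ (ν - 1) * besselKernel b r y with hF
  have hFexp : ∀ y : ℝ, 0 < y → ∀ r : ℝ, F r y =
      (y : ℂ) ^ (ν - 1) * Complex.exp (-(b * y : ℝ)) * Complex.exp ((-b / y : ℂ) * r) := by
    intro y hy r
    rw [mul_assoc, ← Complex.exp_add, hF]
    simp only [besselKernel]
    congr 2
    push_cast
    ring
  have hre : ∀ y : ℝ, 0 < y → (-b / y : ℂ).re < 0 := by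
    intro y hy
    rw [Complex.div_ofReal_re, Complex.neg_re, Complex.ofReal_re]
    exact div_neg_of_neg_of_pos (neg_lt_zero.2 hb) hy
  have hinner : ∀ y : ℝ, 0 < y → ∫ r in Ioi (0 : ℝ), F r y =
      (b : ℂ)⁻¹ * ((y : ℂ) ^ (ν + 1 - 1) * Complex.exp (-(b * y : ℝ))) := by
    intro y hy
    have hy0 : (y : ℂ) ≠ 0 := by exact_mod_cast hy.ne'
    have hb0 : (b : ℂ) ≠ 0 := by exact_mod_cast hb.ne'
    simp_rw [hFexp y hy]
    rw [integral_const_mul, integral_exp_mul_complex_Ioi (hre y hy), Complex.ofReal_zero, mul_zero,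
      Complex.exp_zero, show ν + 1 - 1 = (ν - 1) + 1 by ring, Complex.cpow_add _ _ hy0,
      Complex.cpow_one]
    field_simp
  have hint : Integrable (Function.uncurry F)
      ((volume.restrict (Ioi (0 : ℝ))).prod (volume.restrict (Ioi (0 : ℝ)))) := by
    rw [integrable_prod_iff']
    · constructor
      · filter_upwards [ae_restrict_mem measurableSet_Ioi] with y hy
        simp only [Function.uncurry, hFexp y hy]
        exact (integrableOn_exp_mul_complex_Ioi (hre y hy) 0).const_mul _
      · have h0 := (integrableOn_rpow_mul_exp_neg_mul (show 0 < ν.re + 1 by linarith) hb).const_mul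
          b⁻¹
        refine h0.congr ?_
        filter_upwards [ae_restrict_mem measurableSet_Ioi] with y hy
        have hy0 : 0 < y := hy
        have hn : ∀ r : ℝ, ‖F r y‖ = y ^ (ν.re - 1) * Real.exp (-b * y) *
            Real.exp ((-b / y) * r) := by
          intro r
          rw [hF, norm_mul, Complex.norm_cpow_eq_rpow_re_of_pos hy0, norm_besselKernel, mul_assoc]
          congr 3
          rw [Complex.ofReal_re]
          ring
        simp only [Function.uncurry, hn]
        rw [integral_const_mul, integral_exp_mul_Ioi (div_neg_of_neg_of_pos (neg_lt_zero.2 hb) hy0),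
          mul_zero, Real.exp_zero, show ν.re + 1 - 1 = (ν.re - 1) + 1 by ring,
          Real.rpow_add hy0, Real.rpow_one]
        field_simp
    · refine Measurable.aestronglyMeasurable ?_
      simp only [Function.uncurry_def, hF, besselKernel]
      fun_prop
  calc ∫ r : ℝ in Ioi 0, besselInt b ν r
      = ∫ r : ℝ in Ioi 0, ∫ y : ℝ in Ioi 0, F r y := rfl
    _ = ∫ y : ℝ in Ioi 0, ∫ r : ℝ in Ioi 0, F r y := integral_integral_swap hint
    _ = ∫ y : ℝ in Ioi 0, (b : ℂ)⁻¹ * ((y : ℂ) ^ (ν + 1 - 1) * Complex.exp (-(b * y : ℝ))) :=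
        setIntegral_congr_fun measurableSet_Ioi fun y hy => hinner y hy
    _ = _ := by
        rw [integral_const_mul, ← Complex.integral_cpow_mul_exp_neg_mul_Ioi (by simp; linarith) hb]
        push_cast
        rfl

theorem exists_besselInt_ne_zero {b : ℝ} (hb : 0 < b) {ν : ℂ} (hν : -1 < ν.re) :
    ∃ r : ℝ, 0 < r ∧ besselInt b ν r ≠ 0 := by
  by_contra! h
  have h1 := integral_besselInt hb hν
  rw [setIntegral_congr_fun (g := fun _ => (0 : ℂ)) measurableSet_Ioi fun r hr => h r hr,
    integral_zero] at h1
  have hb0 : (b : ℂ) ≠ 0 := by exact_mod_cast hb.ne'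
  refine mul_ne_zero (inv_ne_zero hb0) (mul_ne_zero ?_ ?_) h1.symm
  · exact (Complex.cpow_ne_zero_iff_of_exponent_ne_zero (fun h => by
      have := congrArg Complex.re h; simp at this; linarith)).2 (one_div_ne_zero hb0)
  · exact Complex.Gamma_ne_zero_of_re_pos (by simp; linarith)

/-! ### Fourier transforms of powers of `1 + ‖x‖ ^ 2`, and the basic functions. -/

theorem gamma_mul_one_add_normSq_cpow {E : Type*} [NormedAddCommGroup E] {A : ℂ} (hA : 0 < A.re) {B : ℝ} (hB : 0 < B) (x : E) :
    (1 / B : ℂ) ^ A * Complex.Gamma A * ((1 + ‖x‖ ^ 2 : ℝ) : ℂ) ^ (-A) =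
      ∫ y : ℝ in Ioi 0, (y : ℂ) ^ (A - 1) * Complex.exp (-((B * (1 + ‖x‖ ^ 2) : ℝ) * y)) := by
  have hx : 0 < 1 + ‖x‖ ^ 2 := by positivity
  rw [Complex.integral_cpow_mul_exp_neg_mul_Ioi hA (by positivity)]
  have h1 : (1 / ((B * (1 + ‖x‖ ^ 2) : ℝ) : ℂ)) = ((1 / B : ℝ) : ℂ) * (((1 + ‖x‖ ^ 2)⁻¹ : ℝ) : ℂ) := by
    push_cast
    field_simp
  have h2 : ((1 + ‖x‖ ^ 2 : ℝ) : ℂ) ^ (-A) = (((1 + ‖x‖ ^ 2)⁻¹ : ℝ) : ℂ) ^ A := by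
    rw [Complex.ofReal_inv, Complex.inv_cpow, Complex.cpow_neg]
    rw [Complex.arg_ofReal_of_nonneg hx.le]
    exact Real.pi_pos.ne
  rw [h1, Complex.mul_cpow_ofReal_nonneg (by positivity) (by positivity), h2]
  push_cast
  ring

section Fourier

variable {E : Type*} [NormedAddCommGroup E] [InnerProductSpace ℝ E] [FiniteDimensional ℝ E]
  [MeasurableSpace E] [BorelSpace E]

/-- Under the Gamma integral, the Gaussian of rate `B y` transforms to `(π / (B y)) ^ (d/2) exp(-B
‖w‖ ^ 2 / y)`; the frequency `2 B` is chosen to produce this exponent. The bound on `Re A` is what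
absolute convergence in Fubini needs. -/
theorem fourier_one_add_normSq_cpow {A : ℂ} (hA : (Module.finrank ℝ E : ℝ) / 2 < A.re) {B : ℝ}
    (hB : 0 < B) (w : E) :
    (1 / B : ℂ) ^ A * Complex.Gamma A *
        ∫ x : E, Complex.exp (2 * B * Complex.I * (inner ℝ w x : ℝ)) *
          ((1 + ‖x‖ ^ 2 : ℝ) : ℂ) ^ (-A) =
      (Real.pi / B : ℂ) ^ (Module.finrank ℝ E / 2 : ℂ) *
        besselInt B (A - Module.finrank ℝ E / 2) ((‖w‖ ^ 2 : ℝ) : ℂ) := by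
  set d : ℝ := (Module.finrank ℝ E : ℝ) / 2 with hd
  have hdC : (Module.finrank ℝ E / 2 : ℂ) = (d : ℂ) := by rw [hd]; push_cast; rfl
  have hd0 : 0 ≤ d := by positivity
  have hA0 : 0 < A.re := by linarith
  set F : E → ℝ → ℂ := fun x y => Complex.exp (2 * B * Complex.I * (inner ℝ w x : ℝ)) *
    ((y : ℂ) ^ (A - 1) * Complex.exp (-((B * (1 + ‖x‖ ^ 2) : ℝ) * y))) with hF
  have hFexp : ∀ (y : ℝ) (x : E), F x y = (y : ℂ) ^ (A - 1) * Complex.exp (-(B * y : ℝ)) *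
      Complex.exp (-(B * y : ℝ) * (‖x‖ : ℂ) ^ 2 + 2 * B * Complex.I * (inner ℝ w x : ℝ)) := by
    intro y x
    simp only [hF]
    rw [mul_assoc ((y : ℂ) ^ (A - 1)), ← Complex.exp_add, mul_left_comm, ← Complex.exp_add]
    congr 2
    push_cast
    ring
  have hre : ∀ y : ℝ, 0 < y → 0 < ((B * y : ℝ) : ℂ).re := fun y hy => by
    rw [Complex.ofReal_re]; positivity
  have hpow : ∀ y : ℝ, 0 < y → (Real.pi / (B * y : ℝ) : ℂ) ^ (d : ℂ) =
      (Real.pi / B : ℂ) ^ (d : ℂ) * (y : ℂ) ^ (-d : ℂ) := by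
    intro y hy
    have h1 : (Real.pi / (B * y : ℝ) : ℂ) = ((Real.pi / B : ℝ) : ℂ) * ((y⁻¹ : ℝ) : ℂ) := by
      push_cast
      field_simp
    rw [h1, Complex.mul_cpow_ofReal_nonneg (by positivity) (by positivity), Complex.ofReal_inv,
      Complex.inv_cpow, Complex.cpow_neg]
    · push_cast; rfl
    · rw [Complex.arg_ofReal_of_nonneg hy.le]
      exact Real.pi_pos.ne
  have hinner : ∀ y : ℝ, 0 < y → ∫ x, F x y = (Real.pi / B : ℂ) ^ (d : ℂ) *
      ((y : ℂ) ^ (A - d - 1) * besselKernel B ((‖w‖ ^ 2 : ℝ) : ℂ) y) := by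
    intro y hy
    have hy0 : (y : ℂ) ≠ 0 := by exact_mod_cast hy.ne'
    have hB0 : (B : ℂ) ≠ 0 := by exact_mod_cast hB.ne'
    simp_rw [hFexp y]
    rw [integral_const_mul, GaussianFourier.integral_cexp_neg_mul_sq_norm_add (hre y hy), hdC,
      hpow y hy, show A - d - 1 = (A - 1) + (-d : ℂ) by ring, Complex.cpow_add _ _ hy0]
    have hk : besselKernel B ((‖w‖ ^ 2 : ℝ) : ℂ) y = Complex.exp (-(B * y : ℝ)) *
        Complex.exp ((2 * B * Complex.I) ^ 2 * (‖w‖ : ℂ) ^ 2 / (4 * (B * y : ℝ))) := by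
      rw [besselKernel, ← Complex.exp_add, mul_pow, Complex.I_sq]
      congr 1
      push_cast
      field_simp
      ring
    rw [hk]
    ring
  have hint : Integrable (Function.uncurry F)
      ((volume : Measure E).prod (volume.restrict (Ioi (0 : ℝ)))) := by
    rw [integrable_prod_iff']
    · constructor
      · filter_upwards [ae_restrict_mem measurableSet_Ioi] with y hy
        simp only [Function.uncurry, hFexp y]
        exact (GaussianFourier.integrable_cexp_neg_mul_sq_norm_add (hre y hy) _ w).const_mul _
      · have h0 := (integrableOn_rpow_mul_exp_neg_mul (show 0 < A.re - d by linarith) hB).const_mul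
          ((Real.pi / B) ^ d)
        refine h0.congr ?_
        filter_upwards [ae_restrict_mem measurableSet_Ioi] with y hy
        have hy0 : 0 < y := hy
        have hn : ∀ x : E, ‖F x y‖ = y ^ (A.re - 1) * Real.exp (-B * y) *
            Real.exp (-(B * y) * ‖x‖ ^ 2) := by
          intro x
          rw [hFexp, norm_mul, norm_mul, Complex.norm_cpow_eq_rpow_re_of_pos hy0, Complex.norm_exp,
            Complex.norm_exp]
          congr 2
          · simp
          · simp [← Complex.ofReal_pow]
        simp only [Function.uncurry, hn]
        rw [integral_const_mul, GaussianFourier.integral_rexp_neg_mul_sq_norm (by positivity), ← hd,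
          ← div_div, Real.div_rpow (by positivity) hy0.le,
          show A.re - d - 1 = (A.re - 1) - d by ring, Real.rpow_sub hy0]
        ring
    · refine Measurable.aestronglyMeasurable ?_
      simp only [Function.uncurry_def, hF]
      fun_prop
  calc _ = ∫ x : E, ∫ y : ℝ in Ioi 0, F x y := by
        rw [← integral_const_mul]
        congr 1
        ext x
        rw [mul_left_comm, gamma_mul_one_add_normSq_cpow hA0 hB, ← integral_const_mul]
    _ = ∫ y : ℝ in Ioi 0, ∫ x : E, F x y := integral_integral_swap hint
    _ = ∫ y : ℝ in Ioi 0, (Real.pi / B : ℂ) ^ (d : ℂ) *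
      ((y : ℂ) ^ (A - d - 1) * besselKernel B ((‖w‖ ^ 2 : ℝ) : ℂ) y) :=
        setIntegral_congr_fun measurableSet_Ioi fun y hy => hinner y hy
    _ = _ := by
        rw [integral_const_mul, hdC]
        rfl

end Fourier

theorem ofReal_cpow_eq_exp {p : ℝ} (hp : 0 < p) (z : ℂ) :
    (p : ℂ) ^ z = Complex.exp ((Real.log p : ℝ) * z) := by
  rw [Complex.cpow_def_of_ne_zero (by exact_mod_cast hp.ne'), Complex.ofReal_log hp.le]

theorem heightReal_cpow (x : ℝ) (w : ℂ) :
    (heightReal x : ℂ) ^ (2 - 2 * w) = ((1 + ‖x‖ ^ 2 : ℝ) : ℂ) ^ (-(1 - w)) := by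
  have hx : 0 < 1 + x ^ 2 := by positivity
  rw [heightReal, Real.norm_eq_abs, sq_abs, ofReal_cpow_eq_exp (by positivity),
    ofReal_cpow_eq_exp hx, Real.log_inv, Real.log_sqrt hx.le]
  congr 1
  push_cast
  ring

theorem heightComplex_cpow (x : ℂ) (w : ℂ) :
    (heightComplex x : ℂ) ^ (2 - 2 * w) = ((1 + ‖x‖ ^ 2 : ℝ) : ℂ) ^ (-(2 - 2 * w)) := by
  have hx : 0 < 1 + ‖x‖ ^ 2 := by positivity
  rw [heightComplex, ofReal_cpow_eq_exp (by positivity), ofReal_cpow_eq_exp hx, Real.log_inv]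
  congr 1
  push_cast
  ring

/-- The case `A = 1 - w`, `B = π`: the zeta factor is exactly `(1 / B) ^ A * Γ(A)`, and `π / B = 1`.
-/
theorem basicReal_eq (s : ℂ) {u : ℝ} (hu : u ≠ 0) :
    basicReal s u = besselInt Real.pi (1 / 2 - s) ((‖u‖ ^ 2 : ℝ) : ℂ) := by
  have hr : 0 < ((‖u‖ ^ 2 : ℝ) : ℂ).re := by rw [Complex.ofReal_re]; positivity
  refine continuation_eq (g := fun w => besselInt Real.pi (1 / 2 - w) ((‖u‖ ^ 2 : ℝ) : ℂ))
    ((differentiable_besselInt_order Real.pi_pos hr).comp (by fun_prop)) (fun w hw => ?_) s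
  have hA : (Module.finrank ℝ ℝ : ℝ) / 2 < (1 - w).re := by simp; linarith
  have h := fourier_one_add_normSq_cpow hA Real.pi_pos u
  have hpi : (Real.pi : ℂ) ≠ 0 := by exact_mod_cast Real.pi_pos.ne'
  rw [div_self hpi, Complex.one_cpow, one_mul] at h
  have h1 : (1 - w) - (Module.finrank ℝ ℝ / 2 : ℂ) = 1 / 2 - w := by simp; ring
  rw [h1] at h
  rw [← h, zetaReal]
  congr 1
  · rw [one_div, Complex.inv_cpow, ← Complex.cpow_neg]
    · congr 2 <;> ring_nf
    · rw [Complex.arg_ofReal_of_nonneg Real.pi_pos.le]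
      exact Real.pi_pos.ne
  · congr 1
    ext x
    congr 1
    · rw [psiReal]
      congr 1
      simp
      ring
    · exact (heightReal_cpow x w).symm

theorem basicComplex_eq (s : ℂ) {u : ℂ} (hu : u ≠ 0) :
    basicComplex s u =
      2 * Real.pi * besselInt (2 * Real.pi) (1 - 2 * s) ((‖u‖ ^ 2 : ℝ) : ℂ) := by
  have hr : 0 < ((‖u‖ ^ 2 : ℝ) : ℂ).re := by rw [Complex.ofReal_re]; positivity
  have hpi : (0 : ℝ) < 2 * Real.pi := by positivity
  refine continuation_eq (g := fun w => 2 * Real.pi *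
    besselInt (2 * Real.pi) (1 - 2 * w) ((‖u‖ ^ 2 : ℝ) : ℂ))
    (((differentiable_besselInt_order hpi hr).comp (f := fun w => 1 - 2 * w)
      (by fun_prop)).const_mul _) (fun w hw => ?_) s
  have hA : (Module.finrank ℝ ℂ : ℝ) / 2 < (2 - 2 * w).re := by simp; linarith
  -- The conjugate appears because `Re (u z)` is the real inner product of `conj u` and `z`.
  have h := fourier_one_add_normSq_cpow hA hpi ((starRingEnd ℂ) u)
  have h1 : (2 - 2 * w) - (Module.finrank ℝ ℂ / 2 : ℂ) = 1 - 2 * w := by simp; ring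
  have hpC : (Real.pi : ℂ) ≠ 0 := by exact_mod_cast Real.pi_pos.ne'
  have h2 : (Real.pi / (2 * Real.pi : ℝ) : ℂ) ^ (Module.finrank ℝ ℂ / 2 : ℂ) = 1 / 2 := by
    simp
    field_simp
  rw [h1, h2, RCLike.norm_conj] at h
  -- The factor `2` of the self-dual measure cancels `π / B = 1 / 2`.
  have h3 : besselInt (2 * Real.pi) (1 - 2 * w) ((‖u‖ ^ 2 : ℝ) : ℂ) =
      2 * (1 / 2 * besselInt (2 * Real.pi) (1 - 2 * w) ((‖u‖ ^ 2 : ℝ) : ℂ)) := by ring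
  rw [h3, ← h, zetaComplex, haarComplex, integral_smul_measure]
  have h4 : (2 * Real.pi : ℂ) ^ (1 - (2 - 2 * w)) =
      2 * Real.pi * (1 / (2 * Real.pi : ℝ) : ℂ) ^ (2 - 2 * w) := by
    rw [Complex.cpow_sub _ _ (by simp [hpC]), Complex.cpow_one, one_div, Complex.inv_cpow]
    · push_cast
      rfl
    · rw [Complex.arg_ofReal_of_nonneg hpi.le]
      exact Real.pi_pos.ne
  have h5 : ∀ z : ℂ, psiComplex (u * z) * (heightComplex z : ℂ) ^ (2 - 2 * w) =
      Complex.exp (2 * (2 * Real.pi : ℝ) * Complex.I * (inner ℝ ((starRingEnd ℂ) u) z : ℝ)) *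
          ((1 + ‖z‖ ^ 2 : ℝ) : ℂ) ^ (-(2 - 2 * w)) := by
    intro z
    rw [heightComplex_cpow, psiComplex, Complex.inner, Complex.conj_conj]
    congr 2
    push_cast
    ring_nf
  simp_rw [h5]
  rw [h4, ENNReal.toReal_ofNat, Complex.real_smul]
  push_cast
  ring

open scoped FourierTransform SchwartzMap ContDiff

/-! ### Exponentially decaying functions are determined by their moments. -/

section Moments

variable {E : Type*} [NormedAddCommGroup E] [InnerProductSpace ℝ E] [FiniteDimensional ℝ E]
  [MeasurableSpace E] [BorelSpace E]

/-- In polar coordinates the square becomes `r ^ (d - 3/2) exp(-2r)`, integrable at `0` since `d ≥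
1`. -/
theorem memLp_exp_neg_norm_mul_rpow [Nontrivial E] :
    MemLp (fun x : E => Real.exp (-‖x‖) * ‖x‖ ^ (-(1 / 4) : ℝ)) 2 volume := by
  rw [memLp_two_iff_integrable_sq (Measurable.aestronglyMeasurable (by fun_prop)),
    integrable_fun_norm_addHaar volume
      (f := fun r : ℝ => (Real.exp (-r) * r ^ (-(1 / 4) : ℝ)) ^ 2)]
  have hd : 1 ≤ Module.finrank ℝ E := Module.finrank_pos
  have hd' : (1 : ℝ) ≤ Module.finrank ℝ E := by exact_mod_cast hd
  refine (integrableOn_rpow_mul_exp_neg_mul (σ := Module.finrank ℝ E - 1 / 2) (c := 2)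
    (by linarith) two_pos).congr_fun (fun r hr => ?_) measurableSet_Ioi
  have hr0 : 0 < r := hr
  have h1 : Real.exp (-r) ^ 2 = Real.exp (-2 * r) := by
    rw [← Real.exp_nat_mul]
    congr 1
    push_cast
    ring
  have h2 : (r ^ (-(1 / 4) : ℝ)) ^ 2 = r ^ (-(1 / 2) : ℝ) := by
    rw [← Real.rpow_natCast, ← Real.rpow_mul hr0.le]
    congr 1
    norm_num
  have h3 : r ^ (Module.finrank ℝ E - 1) = r ^ ((Module.finrank ℝ E : ℝ) - 1) := by
    rw [← Real.rpow_natCast, Nat.cast_sub hd, Nat.cast_one]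
  simp only [smul_eq_mul]
  rw [mul_pow, h1, h2, h3, mul_left_comm, ← Real.rpow_add hr0, mul_comm]
  congr 2
  ring

/-- Half of the rate `c` absorbs the polynomial, the other half the exponential. -/
theorem integrable_pow_inner_mul {φ : E → ℂ} (hφm : AEStronglyMeasurable φ volume) {c : ℝ}
    (hc : 0 < c) (hφ : Integrable (fun x => Real.exp (c * ‖x‖) * ‖φ x‖) volume) (ξ : E) (n : ℕ)
    {h : ℝ} (hh : |h| * ‖ξ‖ ≤ c / 2) :
    Integrable (fun x => ‖((inner ℝ ξ x : ℝ) : ℂ) ^ n * φ x‖ * Real.exp (|h| * |inner ℝ ξ x|))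
      volume := by
  refine (hφ.const_mul (‖ξ‖ ^ n * (n.factorial / (c / 2) ^ n))).mono' ?_ ?_
  · have h1 : AEStronglyMeasurable (fun x : E => ((inner ℝ ξ x : ℝ) : ℂ) ^ n) volume := by
      fun_prop
    have h2 : AEStronglyMeasurable (fun x : E => Real.exp (|h| * |inner ℝ ξ x|)) volume :=
      Continuous.aestronglyMeasurable (by fun_prop)
    exact (h1.mul hφm).norm.mul h2
  · refine Eventually.of_forall fun x => ?_
    have hin : |inner ℝ ξ x| ≤ ‖ξ‖ * ‖x‖ := abs_real_inner_le_norm ξ x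
    have h1 := Real.pow_div_factorial_le_exp (c / 2 * ‖x‖) (by positivity) n
    have h2 : ‖x‖ ^ n ≤ n.factorial / (c / 2) ^ n * Real.exp (c / 2 * ‖x‖) := by
      rw [div_le_iff₀ (by positivity), mul_pow] at h1
      rw [div_mul_eq_mul_div, le_div_iff₀ (by positivity)]
      linarith
    have h3 : Real.exp (|h| * |inner ℝ ξ x|) ≤ Real.exp (c / 2 * ‖x‖) := by
      apply Real.exp_le_exp.2
      calc |h| * |inner ℝ ξ x| ≤ |h| * (‖ξ‖ * ‖x‖) := by gcongr
        _ = |h| * ‖ξ‖ * ‖x‖ := by ring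
        _ ≤ _ := by gcongr
    rw [Real.norm_of_nonneg (by positivity), norm_mul, norm_pow, Complex.norm_real,
      Real.norm_eq_abs]
    calc |inner ℝ ξ x| ^ n * ‖φ x‖ * Real.exp (|h| * |inner ℝ ξ x|)
        ≤ (‖ξ‖ * ‖x‖) ^ n * ‖φ x‖ * Real.exp (c / 2 * ‖x‖) := by gcongr
      _ = ‖ξ‖ ^ n * ‖x‖ ^ n * ‖φ x‖ * Real.exp (c / 2 * ‖x‖) := by rw [mul_pow]
      _ ≤ ‖ξ‖ ^ n * (n.factorial / (c / 2) ^ n * Real.exp (c / 2 * ‖x‖)) * ‖φ x‖ *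
            Real.exp (c / 2 * ‖x‖) := by gcongr
      _ = ‖ξ‖ ^ n * (n.factorial / (c / 2) ^ n) *
            (Real.exp (c / 2 * ‖x‖ + c / 2 * ‖x‖) * ‖φ x‖) := by rw [Real.exp_add]; ring
      _ = _ := by congr 3; ring

/-- Expanding `exp(i h ⟨ξ, x⟩)` in its power series and integrating termwise leaves only moments
twisted at `t`. The admissible step `h` does not depend on `t`, so steps can be iterated. -/
theorem integral_pow_inner_mul_cexp_eq_zero_of_step {φ : E → ℂ}
    (hφm : AEStronglyMeasurable φ volume) {c : ℝ} (hc : 0 < c)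
    (hφ : Integrable (fun x => Real.exp (c * ‖x‖) * ‖φ x‖) volume) (ξ : E) {h t : ℝ}
    (hh : |h| * ‖ξ‖ ≤ c / 2)
    (h0 : ∀ n : ℕ, ∫ x, ((inner ℝ ξ x : ℝ) : ℂ) ^ n * φ x *
      Complex.exp (t * (inner ℝ ξ x : ℝ) * Complex.I) = 0) (n : ℕ) :
    ∫ x, ((inner ℝ ξ x : ℝ) : ℂ) ^ n * φ x *
      Complex.exp ((t + h : ℝ) * (inner ℝ ξ x : ℝ) * Complex.I) = 0 := by
  have hexp : ∀ x : E, HasSum (fun m : ℕ => (|h| * |inner ℝ ξ x|) ^ m / (m.factorial : ℝ))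
      (Real.exp (|h| * |inner ℝ ξ x|)) := fun x => by
    rw [Real.exp_eq_exp_ℝ]
    exact NormedSpace.expSeries_div_hasSum_exp _
  have key := hasSum_integral_of_dominated_convergence (μ := (volume : Measure E))
    (F := fun (m : ℕ) x => ((inner ℝ ξ x : ℝ) : ℂ) ^ n * φ x *
      Complex.exp (t * (inner ℝ ξ x : ℝ) * Complex.I) *
        ((h * (inner ℝ ξ x : ℝ) * Complex.I) ^ m / (m.factorial : ℂ)))
    (f := fun x => ((inner ℝ ξ x : ℝ) : ℂ) ^ n * φ x *
      Complex.exp ((t + h : ℝ) * (inner ℝ ξ x : ℝ) * Complex.I))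
    (fun m x => ‖((inner ℝ ξ x : ℝ) : ℂ) ^ n * φ x‖ *
      ((|h| * |inner ℝ ξ x|) ^ m / (m.factorial : ℝ))) ?_ ?_ ?_ ?_ ?_
  · refine key.unique ?_
    have hz : ∀ m : ℕ, ∫ x, ((inner ℝ ξ x : ℝ) : ℂ) ^ n * φ x *
      Complex.exp (t * (inner ℝ ξ x : ℝ) * Complex.I) *
        ((h * (inner ℝ ξ x : ℝ) * Complex.I) ^ m / (m.factorial : ℂ)) = 0 := by
      intro m
      have : ∀ x : E, ((inner ℝ ξ x : ℝ) : ℂ) ^ n * φ x *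
          Complex.exp (t * (inner ℝ ξ x : ℝ) * Complex.I) *
            ((h * (inner ℝ ξ x : ℝ) * Complex.I) ^ m / (m.factorial : ℂ)) =
          ((h * Complex.I) ^ m / (m.factorial : ℂ)) * (((inner ℝ ξ x : ℝ) : ℂ) ^ (n + m) * φ x *
            Complex.exp (t * (inner ℝ ξ x : ℝ) * Complex.I)) := fun x => by
        rw [pow_add, mul_right_comm (h : ℂ), mul_pow]
        ring
      simp_rw [this]
      rw [integral_const_mul, h0, mul_zero]
    simp_rw [hz]
    exact hasSum_zero
  · intro m
    have h1 : AEStronglyMeasurable (fun x : E => ((inner ℝ ξ x : ℝ) : ℂ) ^ n) volume := by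
      fun_prop
    have h2 : AEStronglyMeasurable (fun x : E =>
        Complex.exp (t * (inner ℝ ξ x : ℝ) * Complex.I)) volume :=
      Continuous.aestronglyMeasurable (by fun_prop)
    have h3 : AEStronglyMeasurable (fun x : E =>
        (h * (inner ℝ ξ x : ℝ) * Complex.I) ^ m / (m.factorial : ℂ)) volume :=
      Continuous.aestronglyMeasurable (by fun_prop)
    exact ((h1.mul hφm).mul h2).mul h3
  · intro m
    refine Eventually.of_forall fun x => le_of_eq ?_
    rw [norm_mul, norm_mul _ (Complex.exp _), ← Complex.ofReal_mul, Complex.norm_exp_ofReal_mul_I,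
      mul_one, norm_div, norm_pow, norm_mul _ Complex.I, norm_mul (h : ℂ), Complex.norm_I, mul_one, Complex.norm_real,
      Complex.norm_real, Real.norm_eq_abs, Real.norm_eq_abs, RCLike.norm_natCast]
  · exact Eventually.of_forall fun x => ((hexp x).summable).mul_left _
  · simp_rw [tsum_mul_left, (hexp _).tsum_eq]
    exact integrable_pow_inner_mul hφm hc hφ ξ n hh
  · refine Eventually.of_forall fun x => ?_
    have h1 : Complex.exp ((t + h : ℝ) * (inner ℝ ξ x : ℝ) * Complex.I) =
        Complex.exp (t * (inner ℝ ξ x : ℝ) * Complex.I) *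
          Complex.exp (h * (inner ℝ ξ x : ℝ) * Complex.I) := by
      rw [← Complex.exp_add]
      congr 1
      push_cast
      ring
    rw [h1, ← mul_assoc]
    refine HasSum.mul_left _ ?_
    rw [Complex.exp_eq_exp_ℂ]
    exact NormedSpace.expSeries_div_hasSum_exp _

theorem integral_cexp_inner_mul_eq_zero_of_moments {φ : E → ℂ}
    (hφm : AEStronglyMeasurable φ volume) {c : ℝ} (hc : 0 < c)
    (hφ : Integrable (fun x => Real.exp (c * ‖x‖) * ‖φ x‖) volume) (ξ : E)
    (h0 : ∀ n : ℕ, ∫ x, ((inner ℝ ξ x : ℝ) : ℂ) ^ n * φ x = 0) :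
    ∫ x, φ x * Complex.exp ((inner ℝ ξ x : ℝ) * Complex.I) = 0 := by
  -- The path from `t = 0` to `t = 1` is cut into `N` admissible steps; the induction carries all
  -- moments, since one step uses every order.
  obtain ⟨N, hN⟩ := exists_nat_gt (‖ξ‖ / (c / 2))
  have hN0 : (0 : ℝ) < N := lt_of_le_of_lt (by positivity) hN
  have hh : |(1 / N : ℝ)| * ‖ξ‖ ≤ c / 2 := by
    rw [abs_of_pos (by positivity), one_div_mul_eq_div, div_le_iff₀ hN0]
    rw [div_lt_iff₀ (by positivity)] at hN
    linarith
  have key : ∀ k : ℕ, ∀ n : ℕ, ∫ x, ((inner ℝ ξ x : ℝ) : ℂ) ^ n * φ x *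
      Complex.exp ((k * (1 / N) : ℝ) * (inner ℝ ξ x : ℝ) * Complex.I) = 0 := by
    intro k
    induction k with
    | zero => simpa using h0
    | succ k ih =>
      intro n
      have := integral_pow_inner_mul_cexp_eq_zero_of_step hφm hc hφ ξ hh ih n
      rw [show ((k + 1 : ℕ) : ℝ) * (1 / N) = k * (1 / N) + 1 / N by push_cast; ring]
      exact this
  have := key N 0
  rw [mul_one_div_cancel hN0.ne'] at this
  simpa using this

/-- Each test function is `𝓕 (𝓕⁻ G)`; moving `𝓕` onto `φ` shows that `φ` is orthogonal to it. -/
theorem ae_eq_zero_of_fourier_eq_zero {φ : E → ℂ} (hφ : Integrable φ volume)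
    (h : ∀ ξ : E, 𝓕 φ ξ = 0) : ∀ᵐ x, φ x = 0 := by
  refine ae_eq_zero_of_integral_contDiff_smul_eq_zero hφ.locallyIntegrable fun g hg hgs => ?_
  have hs : HasCompactSupport fun x => (g x : ℂ) := hgs.comp_left (g := fun r : ℝ => (r : ℂ)) rfl
  have hd : ContDiff ℝ ∞ fun x => (g x : ℂ) := Complex.ofRealCLM.contDiff.comp hg
  set G : 𝓢(E, ℂ) := hs.toSchwartzMap hd with hG
  have h1 : ∫ x, (𝓕 (𝓕⁻ G : 𝓢(E, ℂ)) : 𝓢(E, ℂ)) x • φ x = 0 := by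
    have := VectorFourier.integral_fourierIntegral_smul_eq_flip (L := innerₗ E) (μ := volume)
      (ν := volume) Real.continuous_fourierChar continuous_inner (𝓕⁻ G : 𝓢(E, ℂ)).integrable hφ
    have h2 : ∀ x, VectorFourier.fourierIntegral Real.fourierChar volume (innerₗ E).flip φ x = 0 := by
      intro x
      rw [flip_innerₗ]
      exact h x
    simp_rw [h2, smul_zero, integral_zero] at this
    exact this
  rw [FourierTransform.fourier_fourierInv_eq] at h1
  rw [← h1]
  rfl

theorem ae_eq_zero_of_moments_eq_zero {φ : E → ℂ} (hφm : AEStronglyMeasurable φ volume) {c : ℝ}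
    (hc : 0 < c) (hφ : Integrable (fun x => Real.exp (c * ‖x‖) * ‖φ x‖) volume)
    (h0 : ∀ (ξ : E) (n : ℕ), ∫ x, ((inner ℝ ξ x : ℝ) : ℂ) ^ n * φ x = 0) :
    ∀ᵐ x, φ x = 0 := by
  have hint : Integrable φ volume := by
    refine hφ.mono' hφm (Eventually.of_forall fun x => ?_)
    exact le_mul_of_one_le_left (norm_nonneg _) (Real.one_le_exp (by positivity))
  refine ae_eq_zero_of_fourier_eq_zero hint fun ξ => ?_
  rw [Real.fourier_eq', ← integral_cexp_inner_mul_eq_zero_of_moments hφm hc hφ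
    ((-2 * Real.pi) • ξ) (h0 _)]
  congr 1
  ext x
  rw [smul_eq_mul, mul_comm, real_inner_smul_left, real_inner_comm]

end Moments

/-! ### Density of polynomial multiples of an exponentially decaying function. -/

section Density

variable {E : Type*} [NormedAddCommGroup E] [InnerProductSpace ℝ E] [FiniteDimensional ℝ E]
  [MeasurableSpace E] [BorelSpace E]

/-- The elements of `L²(μ)` of the form `p f` with `p ∈ A`. -/
def weightedSubmodule (μ : Measure E) (f : E → ℂ) (A : Submodule ℂ (E → ℂ)) :
    Submodule ℂ (Lp ℂ 2 μ) where
  carrier := {g | ∃ p ∈ A, (g : E → ℂ) =ᵐ[μ] fun x => p x * f x}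
  zero_mem' := ⟨0, A.zero_mem, by
    filter_upwards [Lp.coeFn_zero ℂ 2 μ] with x hx
    rw [Pi.zero_apply, zero_mul]
    exact hx⟩
  add_mem' := by
    rintro g₁ g₂ ⟨p₁, hp₁, h₁⟩ ⟨p₂, hp₂, h₂⟩
    refine ⟨p₁ + p₂, A.add_mem hp₁ hp₂, ?_⟩
    filter_upwards [Lp.coeFn_add g₁ g₂, h₁, h₂] with x hx hx₁ hx₂
    rw [hx, Pi.add_apply, hx₁, hx₂, Pi.add_apply, add_mul]
  smul_mem' := by
    rintro a g ⟨p, hp, h⟩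
    refine ⟨a • p, A.smul_mem a hp, ?_⟩
    filter_upwards [Lp.coeFn_smul a g, h] with x hx hx₁
    rw [hx, Pi.smul_apply, hx₁, Pi.smul_apply, smul_eq_mul, smul_eq_mul, mul_assoc]

/-- The orthogonal complement is trivial: for `h` in it, `h * conj f` has zero moments and, by
Cauchy–Schwarz, exponential decay. The scalar `a` accommodates the doubled measure on `ℂ`. -/
theorem dense_weightedSubmodule {μ : Measure E} {a : ENNReal} (ha : a ≠ 0) (ha' : a ≠ ⊤)
    (hμ : μ = a • volume) {f : E → ℂ} {c : ℝ} (hc : 0 < c)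
    (hf : MemLp (fun x => (Real.exp (c * ‖x‖) : ℂ) * f x) 2 volume) (hf0 : ∀ᵐ x, f x ≠ 0)
    (A : Submodule ℂ (E → ℂ)) (hA : ∀ (ξ : E) (n : ℕ), (fun x => ((inner ℝ ξ x : ℝ) : ℂ) ^ n) ∈ A)
    (hAL : ∀ p ∈ A, MemLp (fun x => p x * f x) 2 μ) :
    Dense (weightedSubmodule μ f A : Set (Lp ℂ 2 μ)) := by
  have hae : ∀ {P : E → Prop}, (∀ᵐ x ∂μ, P x) ↔ ∀ᵐ x, P x := fun {P} => by
    rw [hμ, Measure.ae_ennreal_smul_measure_iff ha]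
  have hvol : volume = a⁻¹ • μ := by
    rw [hμ, smul_smul, ENNReal.inv_mul_cancel ha ha', one_smul]
  rw [Submodule.dense_iff_topologicalClosure_eq_top, Submodule.topologicalClosure_eq_top_iff,
    Submodule.eq_bot_iff]
  intro h hh
  have hhL : MemLp (h : E → ℂ) 2 volume := by
    rw [hvol]
    exact (Lp.memLp h).smul_measure (ENNReal.inv_ne_top.2 ha)
  set φ : E → ℂ := fun x => h x * (starRingEnd ℂ) (f x) with hφ
  have hexp : Integrable (fun x => Real.exp (c * ‖x‖) * ‖φ x‖) volume := by
    refine (hhL.integrable_mul hf.star).norm.congr (Eventually.of_forall fun x => ?_)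
    simp only [Pi.mul_apply, Pi.star_apply, hφ, norm_mul, norm_star, RCLike.norm_conj,
      Complex.norm_real, Real.norm_of_nonneg (Real.exp_pos _).le]
    ring
  have hfm : AEStronglyMeasurable f volume := by
    have h1 : AEStronglyMeasurable (fun x : E => ((Real.exp (c * ‖x‖))⁻¹ : ℂ)) volume :=
      Measurable.aestronglyMeasurable (by fun_prop)
    refine (h1.mul hf.1).congr (Eventually.of_forall fun x => ?_)
    have : (Real.exp (c * ‖x‖) : ℂ) ≠ 0 := by exact_mod_cast (Real.exp_pos _).ne'
    simp only [Pi.mul_apply]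
    rw [inv_mul_cancel_left₀ this]
  have hφm : AEStronglyMeasurable φ volume := hhL.1.mul hfm.star
  have hφ0 := ae_eq_zero_of_moments_eq_zero hφm hc hexp fun ξ n => by
    have hmem := hAL _ (hA ξ n)
    have hin := hh (hmem.toLp _) ⟨_, hA ξ n, hmem.coeFn_toLp⟩
    rw [L2.inner_def] at hin
    have h2 : ∫ x, ((inner ℝ ξ x : ℝ) : ℂ) ^ n * φ x ∂μ = 0 := by
      rw [← hin]
      refine integral_congr_ae ?_
      filter_upwards [hmem.coeFn_toLp] with x hx
      rw [hx, RCLike.inner_apply, map_mul, map_pow, Complex.conj_ofReal, hφ]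
      ring
    rw [hvol, integral_smul_measure, h2, smul_zero]
  refine Lp.eq_zero_iff_ae_eq_zero.2 (hae.2 ?_)
  filter_upwards [hφ0, hf0] with x hx hx0
  exact (mul_eq_zero.1 hx).resolve_right ((map_ne_zero _).2 hx0)

end Density

/-! ### Combinations of Bessel integrals stable under the Euler operator. -/

/-- The function `∑ₖ cₖ r^k ∫₀^∞ y^(ν-k-1) exp(-b(y + r/y)) dy`. -/
def besselSum (b : ℝ) (ν : ℂ) (c : Polynomial ℂ) (r : ℂ) : ℂ :=
  c.sum fun k a => a * (r ^ k * besselInt b (ν - k) r)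

theorem besselSum_add (b : ℝ) (ν : ℂ) (c₁ c₂ : Polynomial ℂ) (r : ℂ) :
    besselSum b ν (c₁ + c₂) r = besselSum b ν c₁ r + besselSum b ν c₂ r :=
  Polynomial.sum_add_index _ _ _ (fun _ => zero_mul _) fun _ _ _ => add_mul _ _ _

theorem besselSum_monomial (b : ℝ) (ν : ℂ) (k : ℕ) (a : ℂ) (r : ℂ) :
    besselSum b ν (Polynomial.monomial k a) r = a * (r ^ k * besselInt b (ν - k) r) :=
  Polynomial.sum_monomial_index _ _ (zero_mul _)

theorem exists_hasDerivAt_besselSum {b : ℝ} (hb : 0 < b) (ν : ℂ) (c : Polynomial ℂ) :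
    ∃ c' : Polynomial ℂ, ∀ r : ℂ, 0 < r.re →
      HasDerivAt (besselSum b ν c) (besselSum b ν c' r / r) r := by
  induction c using Polynomial.induction_on' with
  | add p q hp hq =>
    obtain ⟨p', hp⟩ := hp
    obtain ⟨q', hq⟩ := hq
    refine ⟨p' + q', fun r hr => ?_⟩
    rw [besselSum_add, add_div]
    exact ((hp r hr).add (hq r hr)).congr_of_eventuallyEq
      (Eventually.of_forall fun z => besselSum_add b ν p q z)
  | monomial k a =>
    -- With `I` the Bessel integral, `r d/dr (r ^ k I_{ν-k}) = k r ^ k I_{ν-k} - b r ^ (k+1)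
    -- I_{ν-k-1}`.
    refine ⟨Polynomial.monomial k (a * k) + Polynomial.monomial (k + 1) (-a * b), fun r hr => ?_⟩
    have hr0 : r ≠ 0 := fun h => by simp [h] at hr
    have h1 := (((hasDerivAt_pow k r).mul (hasDerivAt_besselInt hb (ν - k) hr)).const_mul a)
    refine (h1.congr_deriv ?_).congr_of_eventuallyEq
      (Eventually.of_forall fun z => besselSum_monomial b ν k a z)
    rw [besselSum_add, besselSum_monomial, besselSum_monomial,
      show ν - ((k + 1 : ℕ) : ℂ) = ν - k - 1 by push_cast; ring]
    rcases k with _ | k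
    · field_simp
      simp
      ring
    · field_simp
      simp
      ring

theorem continuousOn_besselSum {E : Type*} [NormedAddCommGroup E] {b : ℝ} (hb : 0 < b) (ν : ℂ) (c : Polynomial ℂ) :
    ContinuousOn (fun x : E => besselSum b ν c ((‖x‖ ^ 2 : ℝ) : ℂ)) {0}ᶜ := by
  obtain ⟨c', h⟩ := exists_hasDerivAt_besselSum hb ν c
  intro x hx
  have hx0 : 0 < ‖x‖ := norm_pos_iff.2 hx
  have h1 := (h ((‖x‖ ^ 2 : ℝ) : ℂ) (by rw [Complex.ofReal_re]; positivity)).continuousAt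
  have h2 : ContinuousAt (fun x : E => ((‖x‖ ^ 2 : ℝ) : ℂ)) x := by fun_prop
  exact (ContinuousAt.comp (f := fun x : E => ((‖x‖ ^ 2 : ℝ) : ℂ)) h1 h2).continuousWithinAt

theorem exists_norm_besselSum_le {E : Type*} [NormedAddCommGroup E] {b : ℝ} (hb : 0 < b) {ν : ℂ} (hν : 0 ≤ ν.re) (c : Polynomial ℂ) :
    ∃ C : ℝ, 0 ≤ C ∧ ∀ x : E, x ≠ 0 → ‖besselSum b ν c ((‖x‖ ^ 2 : ℝ) : ℂ)‖ ≤
      C * (Real.exp (-b * ‖x‖) * ‖x‖ ^ (-(1 / 4) : ℝ)) := by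
  induction c using Polynomial.induction_on' with
  | add p q hp hq =>
    obtain ⟨C₁, hC₁, hp⟩ := hp
    obtain ⟨C₂, hC₂, hq⟩ := hq
    refine ⟨C₁ + C₂, by positivity, fun x hx => ?_⟩
    rw [besselSum_add, add_mul]
    exact (norm_add_le _ _).trans (add_le_add (hp x hx) (hq x hx))
  | monomial k a =>
    obtain ⟨C, hC, h⟩ := exists_norm_besselInt_le hb hν k
    refine ⟨‖a‖ * C, by positivity, fun x hx => ?_⟩
    have hx0 : 0 < ‖x‖ := norm_pos_iff.2 hx
    have h1 := h (‖x‖ ^ 2) (by positivity)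
    have h2 : (‖x‖ ^ 2) ^ (-(1 / 8) : ℝ) = ‖x‖ ^ (-(1 / 4) : ℝ) := by
      rw [← Real.rpow_natCast, ← Real.rpow_mul hx0.le]
      congr 1
      norm_num
    rw [Real.sqrt_sq hx0.le, h2] at h1
    rw [besselSum_monomial, norm_mul, mul_assoc]
    gcongr

section Radial

variable {E : Type*} [NormedAddCommGroup E] [InnerProductSpace ℝ E] [FiniteDimensional ℝ E]
  [MeasurableSpace E] [BorelSpace E]

theorem aestronglyMeasurable_besselSum [Nontrivial E] {b : ℝ} (hb : 0 < b) (ν : ℂ)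
    (c : Polynomial ℂ) :
    AEStronglyMeasurable (fun x : E => besselSum b ν c ((‖x‖ ^ 2 : ℝ) : ℂ)) volume := by
  have h := (continuousOn_besselSum (E := E) hb ν c).aestronglyMeasurable (μ := volume)
    (measurableSet_singleton (0 : E)).compl
  rwa [restrict_compl_singleton] at h

/-- Growth `exp(2‖x‖)` against decay `exp(-b‖x‖)` leaves `exp(-‖x‖)`. Both `b = π` and `b = 2π`
exceed `3`. -/
theorem memLp_mul_besselSum [Nontrivial E] {b : ℝ} (hb : 3 ≤ b) {ν : ℂ} (hν : 0 ≤ ν.re)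
    (c : Polynomial ℂ) {p : E → ℂ} (hp : Continuous p) {C : ℝ}
    (hpC : ∀ x, ‖p x‖ ≤ C * Real.exp (2 * ‖x‖)) :
    MemLp (fun x : E => p x * besselSum b ν c ((‖x‖ ^ 2 : ℝ) : ℂ)) 2 volume := by
  have hb0 : 0 < b := by linarith
  obtain ⟨D, hD, h⟩ := exists_norm_besselSum_le (E := E) hb0 hν c
  refine (memLp_exp_neg_norm_mul_rpow.const_mul (C * D)).mono
    (hp.aestronglyMeasurable.mul (aestronglyMeasurable_besselSum hb0 ν c)) ?_
  have h0 : ∀ᵐ x : E, x ≠ 0 := by simp [ae_iff]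
  filter_upwards [h0] with x hx
  have hC : 0 ≤ C := by simpa using (norm_nonneg _).trans (hpC 0)
  rw [norm_mul, Real.norm_of_nonneg (by positivity)]
  calc ‖p x‖ * ‖besselSum b ν c ((‖x‖ ^ 2 : ℝ) : ℂ)‖
      ≤ C * Real.exp (2 * ‖x‖) * (D * (Real.exp (-b * ‖x‖) * ‖x‖ ^ (-(1 / 4) : ℝ))) := by
        gcongr
        · exact hpC x
        · exact h x hx
    _ = C * D * (Real.exp (2 * ‖x‖ + -b * ‖x‖) * ‖x‖ ^ (-(1 / 4) : ℝ)) := by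
        rw [Real.exp_add]
        ring
    _ ≤ C * D * (Real.exp (-‖x‖) * ‖x‖ ^ (-(1 / 4) : ℝ)) := by
        have : 2 * ‖x‖ + -b * ‖x‖ ≤ -‖x‖ := by nlinarith [norm_nonneg x]
        gcongr

/-- Away from the origin the zeros fill countably many spheres, each of measure zero. -/
theorem ae_besselInt_normSq_ne_zero [Nontrivial E] {b : ℝ} (hb : 0 < b) {ν : ℂ}
    (hν : -1 < ν.re) : ∀ᵐ x : E, besselInt b ν ((‖x‖ ^ 2 : ℝ) : ℂ) ≠ 0 := by
  obtain ⟨r₀, hr₀, h₀⟩ := exists_besselInt_ne_zero hb hν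
  have hc := countable_zeros_besselInt hb ν (by rwa [Complex.ofReal_re]) h₀
  have h1 : volume (⋃ r ∈ {r : ℝ | 0 < r ∧ besselInt b ν r = 0},
      Metric.sphere (0 : E) (√r)) = 0 := by
    rw [measure_biUnion_null_iff hc]
    exact fun r _ => Measure.addHaar_sphere _ _ _
  have h0 : ∀ᵐ x : E, x ≠ 0 := by simp [ae_iff]
  filter_upwards [measure_eq_zero_iff_ae_notMem.1 h1, h0] with x hx hx0 h
  have hx1 : 0 < ‖x‖ := norm_pos_iff.2 hx0
  refine hx (mem_iUnion₂.2 ⟨‖x‖ ^ 2, ⟨by positivity, h⟩, ?_⟩)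
  rw [mem_sphere_zero_iff_norm, Real.sqrt_sq hx1.le]

end Radial

/-! ### Polynomial weights, and integrability and density for radial Bessel functions. -/

/-- `p` is bounded by a constant times a power of `1 + ‖x‖`. -/
def HasPolynomialGrowth {E : Type*} [NormedAddCommGroup E] (p : E → ℂ) : Prop :=
  ∃ (N : ℕ) (C : ℝ), 0 ≤ C ∧ ∀ x, ‖p x‖ ≤ C * (1 + ‖x‖) ^ N

namespace HasPolynomialGrowth

variable {E : Type*} [NormedAddCommGroup E] {p q : E → ℂ}

theorem const (a : ℂ) : HasPolynomialGrowth fun _ : E => a :=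
  ⟨0, ‖a‖, norm_nonneg _, fun x => by simp⟩

theorem add (hp : HasPolynomialGrowth p) (hq : HasPolynomialGrowth q) :
    HasPolynomialGrowth fun x => p x + q x := by
  obtain ⟨N, C, hC, hp⟩ := hp
  obtain ⟨M, D, hD, hq⟩ := hq
  refine ⟨N + M, C + D, by positivity, fun x => ?_⟩
  have hx : 1 ≤ 1 + ‖x‖ := by linarith [norm_nonneg x]
  have h1 : (1 + ‖x‖) ^ N ≤ (1 + ‖x‖) ^ (N + M) := pow_le_pow_right₀ hx (by omega)
  have h2 : (1 + ‖x‖) ^ M ≤ (1 + ‖x‖) ^ (N + M) := pow_le_pow_right₀ hx (by omega)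
  calc ‖p x + q x‖ ≤ ‖p x‖ + ‖q x‖ := norm_add_le _ _
    _ ≤ C * (1 + ‖x‖) ^ N + D * (1 + ‖x‖) ^ M := add_le_add (hp x) (hq x)
    _ ≤ C * (1 + ‖x‖) ^ (N + M) + D * (1 + ‖x‖) ^ (N + M) := by gcongr
    _ = _ := by ring

theorem mul_of_norm_le (hp : HasPolynomialGrowth p) (hq : ∀ x, ‖q x‖ ≤ ‖x‖) :
    HasPolynomialGrowth fun x => p x * q x := by
  obtain ⟨N, C, hC, hp⟩ := hp
  refine ⟨N + 1, C, hC, fun x => ?_⟩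
  have hx : ‖q x‖ ≤ 1 + ‖x‖ := by linarith [hq x]
  rw [norm_mul, pow_succ, ← mul_assoc]
  gcongr
  exact hp x

theorem exists_le_exp (hp : HasPolynomialGrowth p) :
    ∃ C : ℝ, ∀ x, ‖p x‖ ≤ C * Real.exp (2 * ‖x‖) := by
  obtain ⟨N, C, hC, hp⟩ := hp
  refine ⟨C * (N.factorial * Real.exp 1), fun x => (hp x).trans ?_⟩
  have h1 := Real.pow_div_factorial_le_exp (1 + ‖x‖) (by positivity) N
  rw [div_le_iff₀ (by positivity), Real.exp_add] at h1
  have h2 : Real.exp ‖x‖ ≤ Real.exp (2 * ‖x‖) :=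
    Real.exp_le_exp.2 (by linarith [norm_nonneg x])
  rw [mul_assoc]
  gcongr
  calc (1 + ‖x‖) ^ N ≤ Real.exp 1 * Real.exp ‖x‖ * N.factorial := h1
    _ ≤ Real.exp 1 * Real.exp (2 * ‖x‖) * N.factorial := by gcongr
    _ = _ := by ring

end HasPolynomialGrowth

section Radial

variable {E : Type*} [NormedAddCommGroup E] [InnerProductSpace ℝ E] [FiniteDimensional ℝ E]
  [MeasurableSpace E] [BorelSpace E] [Nontrivial E]

theorem memLp_mul_of_eq_besselSum {b : ℝ} (hb : 3 ≤ b) {ν : ℂ} (hν : 0 ≤ ν.re) {f : E → ℂ}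
    {c : Polynomial ℂ} (hf : ∀ x, x ≠ 0 → f x = besselSum b ν c ((‖x‖ ^ 2 : ℝ) : ℂ)) {p : E → ℂ}
    (hp : Continuous p) {C : ℝ} (hpC : ∀ x, ‖p x‖ ≤ C * Real.exp (2 * ‖x‖)) :
    MemLp (fun x => p x * f x) 2 volume := by
  refine (memLp_congr_ae ?_).1 (memLp_mul_besselSum hb hν c hp hpC)
  have h0 : ∀ᵐ x : E, x ≠ 0 := by simp [ae_iff]
  filter_upwards [h0] with x hx
  rw [hf x hx]

theorem memLp_sum_mul_of_eq_besselSum {b : ℝ} (hb : 3 ≤ b) {ν : ℂ} (hν : 0 ≤ ν.re)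
    {f : ℕ → E → ℂ}
    (hf : ∀ j, ∃ c, ∀ x, x ≠ 0 → f j x = besselSum b ν c ((‖x‖ ^ 2 : ℝ) : ℂ)) {p : ℕ → E → ℂ}
    (hp : ∀ j, Continuous (p j)) (hpg : ∀ j, HasPolynomialGrowth (p j)) (t : Finset ℕ) :
    MemLp (fun x => ∑ j ∈ t, p j x * f j x) 2 volume := by
  refine memLp_finsetSum _ fun j _ => ?_
  obtain ⟨c, hc⟩ := hf j
  obtain ⟨C, hC⟩ := (hpg j).exists_le_exp
  exact memLp_mul_of_eq_besselSum hb hν hc (hp j) hC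

theorem besselSum_monomial_zero (b : ℝ) (ν κ r : ℂ) :
    besselSum b ν (Polynomial.monomial 0 κ) r = κ * besselInt b ν r := by
  rw [besselSum_monomial]
  simp

theorem dense_weightedSubmodule_of_eq_besselInt {μ : Measure E} {a : ENNReal} (ha : a ≠ 0)
    (ha' : a ≠ ⊤) (hμ : μ = a • volume) {b : ℝ} (hb : 3 ≤ b) {ν : ℂ} (hν : 0 ≤ ν.re) {κ : ℂ}
    (hκ : κ ≠ 0) {f : E → ℂ} (hf : ∀ x, x ≠ 0 → f x = κ * besselInt b ν ((‖x‖ ^ 2 : ℝ) : ℂ))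
    (A : Submodule ℂ (E → ℂ)) (hA : ∀ (ξ : E) (n : ℕ), (fun x => ((inner ℝ ξ x : ℝ) : ℂ) ^ n) ∈ A)
    (hAc : ∀ p ∈ A, Continuous p) (hAg : ∀ p ∈ A, HasPolynomialGrowth p) :
    Dense (weightedSubmodule μ f A : Set (Lp ℂ 2 μ)) := by
  have hf' : ∀ x, x ≠ 0 →
      f x = besselSum b ν (Polynomial.monomial 0 κ) ((‖x‖ ^ 2 : ℝ) : ℂ) := fun x hx => by
    rw [hf x hx, besselSum_monomial_zero]
  have h0 : ∀ᵐ x : E, x ≠ 0 := by simp [ae_iff]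
  refine dense_weightedSubmodule ha ha' hμ one_pos ?_ ?_ A hA fun p hp => ?_
  · refine memLp_mul_of_eq_besselSum (C := 1) hb hν hf' (by fun_prop) fun x => ?_
    rw [Complex.norm_real, Real.norm_of_nonneg (Real.exp_pos _).le, one_mul, one_mul]
    exact Real.exp_le_exp.2 (by linarith [norm_nonneg x])
  · filter_upwards [h0, ae_besselInt_normSq_ne_zero (E := E) (show 0 < b by linarith)
      (show -1 < ν.re by linarith)] with x hx hx'
    rw [hf x hx]
    exact mul_ne_zero hκ hx'
  · obtain ⟨C, hC⟩ := (hAg p hp).exists_le_exp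
    rw [hμ]
    exact (memLp_mul_of_eq_besselSum hb hν hf' (hAc p hp) hC).smul_measure ha'

end Radial

/-! ### The real place -/

theorem exists_eulerReal_iterate_eq_besselSum (s : ℂ) (j : ℕ) :
    ∃ c : Polynomial ℂ, ∀ u : ℝ, u ≠ 0 →
      (eulerReal^[j] (basicReal s)) u =
        besselSum Real.pi (1 / 2 - s) c ((‖u‖ ^ 2 : ℝ) : ℂ) := by
  induction j with
  | zero =>
    refine ⟨Polynomial.monomial 0 1, fun u hu => ?_⟩
    rw [besselSum_monomial_zero, one_mul]
    exact basicReal_eq s hu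
  | succ j ih =>
    obtain ⟨c, hc⟩ := ih
    obtain ⟨c', hc'⟩ := exists_hasDerivAt_besselSum Real.pi_pos (1 / 2 - s) c
    -- For `r = u ^ 2`, `u d/du = 2 r d/dr`, hence the doubling.
    refine ⟨c' + c', fun u hu => ?_⟩
    have huC : (u : ℂ) ≠ 0 := by exact_mod_cast hu
    have hev : eulerReal^[j] (basicReal s) =ᶠ[𝓝 u]
        fun u : ℝ => besselSum Real.pi (1 / 2 - s) c ((u : ℂ) ^ 2) := by
      filter_upwards [isOpen_ne.mem_nhds hu] with v hv
      rw [hc v hv, Real.norm_eq_abs, sq_abs]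
      push_cast
      rfl
    have hre : 0 < ((u : ℂ) ^ 2).re := by
      rw [← Complex.ofReal_pow, Complex.ofReal_re]
      positivity
    have h1 : HasDerivAt (fun u : ℝ => (u : ℂ) ^ 2) (2 * u) u := by
      simpa using (hasDerivAt_pow 2 (u : ℂ)).comp_ofReal
    have h2 := HasDerivAt.comp (𝕜 := ℝ) (h := fun u : ℝ => (u : ℂ) ^ 2) u (hc' _ hre) h1
    rw [Function.iterate_succ_apply', eulerReal, hev.deriv_eq]
    rw [show (fun u : ℝ => besselSum Real.pi (1 / 2 - s) c ((u : ℂ) ^ 2)) =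
      besselSum Real.pi (1 / 2 - s) c ∘ fun u : ℝ => (u : ℂ) ^ 2 from rfl, h2.deriv, besselSum_add,
      Real.norm_eq_abs, sq_abs]
    push_cast
    field_simp
    ring

theorem continuous_eval_ofReal (p : Polynomial ℂ) : Continuous fun u : ℝ => p.eval (u : ℂ) :=
  p.continuous.comp Complex.continuous_ofReal

theorem hasPolynomialGrowth_eval_ofReal (p : Polynomial ℂ) :
    HasPolynomialGrowth fun u : ℝ => p.eval (u : ℂ) := by
  induction p using Polynomial.induction_on with
  | C a => simpa using HasPolynomialGrowth.const a
  | add p q hp hq => simpa using hp.add hq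
  | monomial n a ih =>
    have := ih.mul_of_norm_le (q := fun u : ℝ => (u : ℂ)) fun u => by simp
    simpa [pow_succ, mul_assoc] using this

/-- The polynomial functions on `ℝ`. -/
def polynomialFunctionsReal : Submodule ℂ (ℝ → ℂ) :=
  LinearMap.range
    ({ toFun := fun p u => p.eval (u : ℂ)
       map_add' := fun p q => by ext u; simp
       map_smul' := fun a p => by ext u; simp } : Polynomial ℂ →ₗ[ℂ] ℝ → ℂ)

theorem memLp_of_mem_tameReal {s : ℂ} (hs : s.re ≤ 1 / 2) {f : ℝ → ℂ} (hf : f ∈ tameReal s) :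
    MemLp f 2 (volume : Measure ℝ) := by
  obtain ⟨P, rfl⟩ := hf
  exact memLp_sum_mul_of_eq_besselSum Real.pi_gt_three.le (ν := 1 / 2 - s)
    (by simpa using hs) (exists_eulerReal_iterate_eq_besselSum s)
    (fun j => continuous_eval_ofReal (P.coeff j))
    (fun j => hasPolynomialGrowth_eval_ofReal (P.coeff j)) P.support

theorem dense_tameReal {s : ℂ} (hs : s.re ≤ 1 / 2) :
    Dense {g : Lp ℂ 2 (volume : Measure ℝ) | ∃ f ∈ tameReal s, (g : ℝ → ℂ) =ᵐ[volume] f} := by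
  have h := dense_weightedSubmodule_of_eq_besselInt (μ := (volume : Measure ℝ)) one_ne_zero
    ENNReal.one_ne_top (one_smul _ _).symm Real.pi_gt_three.le (ν := 1 / 2 - s) (by simpa using hs)
    one_ne_zero (f := basicReal s) (fun u hu => by rw [one_mul]; exact basicReal_eq s hu)
    polynomialFunctionsReal (fun ξ n => ⟨(Polynomial.C (ξ : ℂ) * Polynomial.X) ^ n, ?_⟩) ?_ ?_
  · refine h.mono ?_
    rintro g ⟨_, ⟨p, rfl⟩, hg⟩
    -- Operators of degree zero in `∂` already give a dense set.
    refine ⟨_, ⟨Polynomial.C p, rfl⟩, hg.trans (Eventually.of_forall fun u => ?_)⟩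
    simp [applyReal, Polynomial.sum_C_index]
  · ext u
    simp only [LinearMap.coe_mk, AddHom.coe_mk, Polynomial.eval_pow, Polynomial.eval_mul,
      Polynomial.eval_C, Polynomial.eval_X, RCLike.inner_apply]
    simp [mul_comm]
  · rintro _ ⟨p, rfl⟩
    exact continuous_eval_ofReal p
  · rintro _ ⟨p, rfl⟩
    exact hasPolynomialGrowth_eval_ofReal p

/-! ### The complex place -/

/-- Since `∂(z z̄)/∂z = z̄`, the operator acts on radial functions as `r d/dr`, without the factor
`2` of the real place. -/
theorem eulerComplex_comp_normSq {S : ℂ → ℂ} {z S' : ℂ}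
    (hS : HasDerivAt S S' ((‖z‖ ^ 2 : ℝ) : ℂ)) :
    eulerComplex (fun z => S ((‖z‖ ^ 2 : ℝ) : ℂ)) z = ((‖z‖ ^ 2 : ℝ) : ℂ) * S' := by
  have h1 : HasFDerivAt (fun z : ℂ => ((‖z‖ ^ 2 : ℝ) : ℂ))
      (Complex.ofRealCLM.comp (2 • innerSL ℝ z)) z :=
    Complex.ofRealCLM.hasFDerivAt.comp z (hasStrictFDerivAt_norm_sq z).hasFDerivAt
  have h2 := HasFDerivAt.comp (f := fun z : ℂ => ((‖z‖ ^ 2 : ℝ) : ℂ)) z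
    (hS.hasFDerivAt.restrictScalars ℝ) h1
  have h3 : (fun z : ℂ => S ((‖z‖ ^ 2 : ℝ) : ℂ)) = S ∘ fun z : ℂ => ((‖z‖ ^ 2 : ℝ) : ℂ) := rfl
  rw [eulerComplex, h3, h2.fderiv]
  have h4 : ((‖z‖ ^ 2 : ℝ) : ℂ) = z * (z.re - Complex.I * z.im) := by
    rw [← Complex.normSq_eq_norm_sq, ← Complex.mul_conj]
    congr 1
    apply Complex.ext <;> simp
  rw [h4]
  simp [Complex.inner]
  ring

theorem exists_eulerComplex_iterate_eq_besselSum (s : ℂ) (j : ℕ) :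
    ∃ c : Polynomial ℂ, ∀ u : ℂ, u ≠ 0 →
      (eulerComplex^[j] (basicComplex s)) u =
        besselSum (2 * Real.pi) (1 - 2 * s) c ((‖u‖ ^ 2 : ℝ) : ℂ) := by
  induction j with
  | zero =>
    refine ⟨Polynomial.monomial 0 (2 * Real.pi), fun u hu => ?_⟩
    rw [besselSum_monomial_zero]
    exact basicComplex_eq s hu
  | succ j ih =>
    obtain ⟨c, hc⟩ := ih
    obtain ⟨c', hc'⟩ := exists_hasDerivAt_besselSum Real.two_pi_pos (1 - 2 * s) c
    refine ⟨c', fun u hu => ?_⟩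
    have hu0 : 0 < ‖u‖ := norm_pos_iff.2 hu
    have hev : eulerComplex^[j] (basicComplex s) =ᶠ[𝓝 u]
        fun u : ℂ => besselSum (2 * Real.pi) (1 - 2 * s) c ((‖u‖ ^ 2 : ℝ) : ℂ) := by
      filter_upwards [isOpen_ne.mem_nhds hu] with v hv using hc v hv
    have hre : 0 < ((‖u‖ ^ 2 : ℝ) : ℂ).re := by rw [Complex.ofReal_re]; positivity
    have hne : ((‖u‖ ^ 2 : ℝ) : ℂ) ≠ 0 := by exact_mod_cast (by positivity : ‖u‖ ^ 2 ≠ 0)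
    have h1 := eulerComplex_comp_normSq (hc' _ hre)
    rw [mul_div_cancel₀ _ hne] at h1
    rw [← h1, Function.iterate_succ_apply']
    simp only [eulerComplex]
    rw [hev.fderiv_eq]

theorem continuous_eval_conj (p : MvPolynomial (Fin 2) ℂ) :
    Continuous fun z : ℂ => MvPolynomial.eval ![z, (starRingEnd ℂ) z] p := by
  refine (MvPolynomial.continuous_eval p).comp (continuous_pi fun i => ?_)
  fin_cases i
  · exact continuous_id
  · exact Complex.continuous_conj

theorem hasPolynomialGrowth_eval_conj (p : MvPolynomial (Fin 2) ℂ) :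
    HasPolynomialGrowth fun z : ℂ => MvPolynomial.eval ![z, (starRingEnd ℂ) z] p := by
  induction p using MvPolynomial.induction_on with
  | C a => simpa using HasPolynomialGrowth.const a
  | add p q hp hq => simpa using hp.add hq
  | mul_X p i ih =>
    have := ih.mul_of_norm_le (q := fun z : ℂ => (![z, (starRingEnd ℂ) z] : Fin 2 → ℂ) i)
      fun z => by fin_cases i <;> simp
    simpa using this

/-- The polynomial functions in `z` and its conjugate on `ℂ`. -/
def polynomialFunctionsComplex : Submodule ℂ (ℂ → ℂ) :=
  LinearMap.range
    ({ toFun := fun p z => MvPolynomial.eval ![z, (starRingEnd ℂ) z] p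
       map_add' := fun p q => by ext u; simp
       map_smul' := fun a p => by ext u; simp [MvPolynomial.smul_eval] } :
      MvPolynomial (Fin 2) ℂ →ₗ[ℂ] ℂ → ℂ)

theorem memLp_of_mem_tameComplex {s : ℂ} (hs : s.re ≤ 1 / 2) {f : ℂ → ℂ}
    (hf : f ∈ tameComplex s) : MemLp f 2 haarComplex := by
  obtain ⟨P, rfl⟩ := hf
  have h := memLp_sum_mul_of_eq_besselSum (b := 2 * Real.pi) (by linarith [Real.pi_gt_three])
    (ν := 1 - 2 * s) (by simp; linarith) (exists_eulerComplex_iterate_eq_besselSum s)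
    (fun j => continuous_eval_conj (P.coeff j))
    (fun j => hasPolynomialGrowth_eval_conj (P.coeff j)) P.support
  exact h.smul_measure ENNReal.ofNat_ne_top

theorem dense_tameComplex {s : ℂ} (hs : s.re ≤ 1 / 2) :
    Dense {g : Lp ℂ 2 haarComplex |
      ∃ f ∈ tameComplex s, (g : ℂ → ℂ) =ᵐ[haarComplex] f} := by
  have hpi : (2 * Real.pi : ℂ) ≠ 0 := by exact_mod_cast Real.two_pi_pos.ne'
  have h := dense_weightedSubmodule_of_eq_besselInt (μ := haarComplex) two_ne_zero
    ENNReal.ofNat_ne_top rfl (b := 2 * Real.pi) (by linarith [Real.pi_gt_three])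
    (ν := 1 - 2 * s) (by simp; linarith) hpi (f := basicComplex s) (fun u hu => basicComplex_eq s hu)
    polynomialFunctionsComplex
    -- The real inner product is `⟨ξ, z⟩ = (ξ̄ z + ξ z̄) / 2`, so the weights must include `z̄` as
    -- well as `z`.
    (fun ξ n => ⟨(MvPolynomial.C ((starRingEnd ℂ) ξ / 2) * MvPolynomial.X 0 +
      MvPolynomial.C (ξ / 2) * MvPolynomial.X 1) ^ n, ?_⟩) ?_ ?_
  · refine h.mono ?_
    rintro g ⟨_, ⟨p, rfl⟩, hg⟩
    refine ⟨_, ⟨Polynomial.C p, rfl⟩, hg.trans (Eventually.of_forall fun u => ?_)⟩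
    simp [applyComplex, Polynomial.sum_C_index]
  · ext z
    simp only [LinearMap.coe_mk, AddHom.coe_mk, map_pow, map_add, map_mul, MvPolynomial.eval_C,
      MvPolynomial.eval_X, Matrix.cons_val_zero, Matrix.cons_val_one]
    congr 1
    apply Complex.ext <;> simp [Complex.inner] <;> ring
  · rintro _ ⟨p, rfl⟩
    exact continuous_eval_conj p
  · rintro _ ⟨p, rfl⟩
    exact hasPolynomialGrowth_eval_conj p

end TameSchwartz

end

theorem mainTheorem7 (s : ℂ) (hs : s.re ≤ 1 / 2) :
    ((∀ f ∈ TameSchwartz.tameReal s, MemLp f 2 (volume : Measure ℝ)) ∧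
      Dense {g : Lp ℂ 2 (volume : Measure ℝ) |
        ∃ f ∈ TameSchwartz.tameReal s, (g : ℝ → ℂ) =ᵐ[volume] f}) ∧
    ((∀ f ∈ TameSchwartz.tameComplex s, MemLp f 2 TameSchwartz.haarComplex) ∧
      Dense {g : Lp ℂ 2 TameSchwartz.haarComplex |
        ∃ f ∈ TameSchwartz.tameComplex s,
          (g : ℂ → ℂ) =ᵐ[TameSchwartz.haarComplex] f}) :=
  ⟨⟨fun _ hf => TameSchwartz.memLp_of_mem_tameReal hs hf, TameSchwartz.dense_tameReal hs⟩,
    ⟨fun _ hf => TameSchwartz.memLp_of_mem_tameComplex hs hf, TameSchwartz.dense_tameComplex hs⟩⟩
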